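/- **Theorem.** Let $\mathbb R^{10}$ with standard basis $\beta_0,\dots,\beta_9$ carry the symmetric bilinear form given by the Gram matrix of the tree $T_{246}$, in which $\beta_1,\beta_2,\dots,\beta_9$ form a path in this order and $\beta_0$ is joined to $\beta_4$: $\beta_i\cdot\beta_i=-2$, and for $i\ne j$, $\beta_i\cdot\beta_j=1$ if $\beta_i\beta_j$ is an edge and $0$ otherwise. (This form has signature $(1,9)$.) Let $\nu$ be the vector with $\nu\cdot\nu=-2$, $\nu\cdot\beta_9=2$ and $\nu\cdot\beta_i=0$ for $i\neq 9$. Put $R_{v}(x)=x-2\frac{v\cdot x}{v\cdot v}v$ and let $\Gamma=\langle R_{\beta_0},\dots,R_{\beta_9}\rangle$, the Weyl group $W_{246}$ of the tree. Fix $D$ with $D\cdot D>0$, let $\mathcal H=\{x: x\cdot x=1,\ x\cdot D>0\}$ be the corresponding model of hyperbolic space $\mathbb H^9$ and $\mathcal L^+=\{x: x\cdot x=0,\ x\cdot D>0\}$, and suppose that $D$ is chosen (among $\pm D$) so that $\mathcal H$ contains a point $x$ with $\beta_i\cdot x>0$ for all $i$. For every $E\in\mathcal L^+$, the space $\partial\mathcal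 H_E=(\mathcal L^+/\mathbb R^+)\setminus\{E\mathbb R^+\}$ with the metric $|AB|_E^2=\frac{2A\cdot B}{(A\cdot E)(B\cdot E)}$ is isometric to $\mathbb R^8$; a vector $v$ with $v\cdot v<0$ gives in it the sphere or hyperplane $\{A: v\cdot A=0\}$, oriented by its open side $\{A: v\cdot A<0\}$. The orbit $\mathcal P_\beta=\Gamma(\nu)$ is an Apollonian packing in $\mathbb R^8$, that is: 1. (Sphere packing) there is $k>0$ with $v\cdot v=-k$ and $v\cdot w\ge k$ for all distinct $v,w\in\mathcal P_\beta$, and never both $v,-v\in\mathcal P_\beta$; and for every $E\in\mathcal L^+$ any two distinct members of $\mathcal P_\beta$ give spheres in $\partial\mathcal H_E\cong\mathbb R^8$ that meet in at most one point and whose open sides are disjoint. 2. (Crystallographic) there are a lattice $\Lambda$ (the $\mathbb Z$-span of a basis of $\mathbb R^{10}$), a group $G$ of linear isometries of the form preserving $\mathcal H$ and $\Lambda$ which has in $\mathcal H$ a convex fundamental domain with finitely many faces, and a finite set $S\subset\Lambda$, such that $\mathcal P_\beta=G(S)$. 3. (Maximal) for every $E\in\mathcal L^+$, the complement in $\partial\mathcal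 H_E\cong\mathbb R^8$ of the union of the open sides of all members of $\mathcal P_\beta$ contains no ball of positive radius. 4. (Apollonian property) every member of $\mathcal P_\beta$ belongs to a set of ten mutually tangent members of $\mathcal P_\beta$, where linearly independent $v,w$ are tangent if $|v\cdot w|=\sqrt{-v\cdot v}\,\sqrt{-w\cdot w}$. -/

import Mathlib

open scoped Matrix

noncomputable section

namespace Apollonian

/-! ### Lorentz space, hyperbolic space and its boundary

A symmetric matrix `J` of signature `(1, N-1)`, `N = n + 2`, gives the product `u · v = uᵀ J v` on
`ℝ^N`; vectors of positive norm are the timelike ones. A vector `D` with `D · D > 0` selects one of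
the two sheets of `x · x = 1`. -/

/-- The product `u · v = uᵀ J v`. -/
def prod {N : ℕ} (J : Matrix (Fin N) (Fin N) ℝ) (u v : Fin N → ℝ) : ℝ := u ⬝ᵥ (J *ᵥ v)

/-- The vector model of hyperbolic space: the sheet of `x · x = 1` selected by `D`. -/
def hyp {N : ℕ} (J : Matrix (Fin N) (Fin N) ℝ) (D : Fin N → ℝ) : Set (Fin N → ℝ) :=
  {x | prod J x x = 1 ∧ 0 < prod J x D}

/-- The null vectors on the side of `D`; their positive rays are the points of the boundary of
hyperbolic space. -/
def lightCone {N : ℕ} (J : Matrix (Fin N) (Fin N) ℝ) (D : Fin N → ℝ) : Set (Fin N → ℝ) :=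
  {x | prod J x x = 0 ∧ 0 < prod J x D}

/-- Reflection in the hyperplane orthogonal to `v`. -/
def reflect {N : ℕ} (J : Matrix (Fin N) (Fin N) ℝ) (v x : Fin N → ℝ) : Fin N → ℝ :=
  x - (2 * (prod J v x / prod J v v)) • v

/-- The group generated by the reflections in the hyperplanes orthogonal to the vectors `β i`
(for `β i · β i ≠ 0`). -/
def weylGroup {N : ℕ} {ι : Type*} (J : Matrix (Fin N) (Fin N) ℝ) (β : ι → Fin N → ℝ) :
    Subgroup ((Fin N → ℝ) ≃ₗ[ℝ] (Fin N → ℝ)) :=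
  Subgroup.closure {g | ∃ i, ∀ x, g x = reflect J (β i) x}

/-- The set `Γ(S)` of all images of elements of `S` under elements of `Γ`. -/
def orbit {N : ℕ} (Γ : Subgroup ((Fin N → ℝ) ≃ₗ[ℝ] (Fin N → ℝ))) (S : Set (Fin N → ℝ)) :
    Set (Fin N → ℝ) :=
  {m | ∃ g ∈ Γ, ∃ v ∈ S, m = g v}

/-! ### Perspectives: identifying the boundary minus a point with Euclidean space -/

/-- `φ` is an isometry of `ℝⁿ` onto the boundary of hyperbolic space minus the point `E`, where the
latter carries the metric `|AB|² = 2 (A · B) / ((A · E) (B · E))`. A boundary point is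
represented by any vector on its ray. -/
structure IsPerspective {n N : ℕ} (J : Matrix (Fin N) (Fin N) ℝ) (D E : Fin N → ℝ)
    (φ : EuclideanSpace ℝ (Fin n) → Fin N → ℝ) : Prop where
  infinity_mem : E ∈ lightCone J D
  mem : ∀ x, φ x ∈ lightCone J D
  ne_infinity : ∀ x, ¬ ∃ c : ℝ, 0 < c ∧ φ x = c • E
  dist_sq : ∀ x y,
    dist x y ^ 2 = 2 * prod J (φ x) (φ y) / (prod J (φ x) E * prod J (φ y) E)
  surj : ∀ A ∈ lightCone J D, (¬ ∃ c : ℝ, 0 < c ∧ A = c • E) →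
    ∃ x, ∃ c : ℝ, 0 < c ∧ A = c • φ x

/-- The sphere (or hyperplane) in `ℝⁿ` bounding the hyperplane orthogonal to `v`. -/
def sphereOf {n N : ℕ} (J : Matrix (Fin N) (Fin N) ℝ)
    (φ : EuclideanSpace ℝ (Fin n) → Fin N → ℝ) (v : Fin N → ℝ) :
    Set (EuclideanSpace ℝ (Fin n)) :=
  {x | prod J v (φ x) = 0}

/-- The open side of that sphere which its orientation counts as belonging to it: a ball, the
exterior of a ball, or a half-space. -/
def sideOf {n N : ℕ} (J : Matrix (Fin N) (Fin N) ℝ)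
    (φ : EuclideanSpace ℝ (Fin n) → Fin N → ℝ) (v : Fin N → ℝ) :
    Set (EuclideanSpace ℝ (Fin n)) :=
  {x | prod J v (φ x) < 0}

/-! ### Packings -/

/-- Packings as sets of vectors: all norms are `-k`, and products of distinct members are at least
`k`. The trivial packing, a sphere with its complement, is excluded. -/
def IsPacking {N : ℕ} (J : Matrix (Fin N) (Fin N) ℝ) (P : Set (Fin N → ℝ)) : Prop :=
  (∃ k : ℝ, 0 < k ∧ (∀ v ∈ P, prod J v v = -k) ∧
    ∀ v ∈ P, ∀ w ∈ P, v ≠ w → k ≤ prod J v w) ∧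
  ∀ v ∈ P, -v ∉ P

/-- The oriented spheres of `P` in the perspective `φ` form a sphere packing of `ℝⁿ`: two of them
have at most one common point and their sides do not overlap. -/
def IsSpherePacking {n N : ℕ} (J : Matrix (Fin N) (Fin N) ℝ)
    (φ : EuclideanSpace ℝ (Fin n) → Fin N → ℝ) (P : Set (Fin N → ℝ)) : Prop :=
  ∀ v ∈ P, ∀ w ∈ P, v ≠ w →
    (sphereOf J φ v ∩ sphereOf J φ w).Subsingleton ∧ Disjoint (sideOf J φ v) (sideOf J φ w)

/-- The residual set: what is left of `ℝⁿ` when the sides of all spheres are removed. -/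
def residualSet {n N : ℕ} (J : Matrix (Fin N) (Fin N) ℝ)
    (φ : EuclideanSpace ℝ (Fin n) → Fin N → ℝ) (P : Set (Fin N → ℝ)) :
    Set (EuclideanSpace ℝ (Fin n)) :=
  (⋃ v ∈ P, sideOf J φ v)ᶜ

/-- No ball of positive radius fits into the residual set. -/
def IsMaximal {n N : ℕ} (J : Matrix (Fin N) (Fin N) ℝ)
    (φ : EuclideanSpace ℝ (Fin n) → Fin N → ℝ) (P : Set (Fin N → ℝ)) : Prop :=
  ∀ (c : EuclideanSpace ℝ (Fin n)) (r : ℝ), 0 < r → ¬ Metric.ball c r ⊆ residualSet J φ P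

/-- Lorentz isometries that preserve the sheet and the set `L`. -/
def IsLatticeIsometry {N : ℕ} (J : Matrix (Fin N) (Fin N) ℝ) (D : Fin N → ℝ)
    (L : Set (Fin N → ℝ)) (g : (Fin N → ℝ) ≃ₗ[ℝ] (Fin N → ℝ)) : Prop :=
  (∀ u v, prod J (g u) (g v) = prod J u v) ∧ g '' hyp J D = hyp J D ∧ g '' L = L

/-- `Γ` has a convex fundamental domain in hyperbolic space with finitely many faces, that is, one
cut out by finitely many half-spaces `v · x ≥ 0`, `v ∈ A`. -/
def IsGeometricallyFinite {N : ℕ} (J : Matrix (Fin N) (Fin N) ℝ) (D : Fin N → ℝ)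
    (Γ : Subgroup ((Fin N → ℝ) ≃ₗ[ℝ] (Fin N → ℝ))) : Prop :=
  ∃ A : Finset (Fin N → ℝ), (∀ v ∈ A, prod J v v < 0) ∧
    {x ∈ hyp J D | ∀ v ∈ A, 0 < prod J v x}.Nonempty ∧
    (⋃ g ∈ Γ, g '' {x ∈ hyp J D | ∀ v ∈ A, 0 ≤ prod J v x}) = hyp J D ∧
    ∀ g ∈ Γ, g ≠ 1 →
      Disjoint (g '' {x ∈ hyp J D | ∀ v ∈ A, 0 < prod J v x})
        {x ∈ hyp J D | ∀ v ∈ A, 0 < prod J v x}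

/-- `P = Γ(S)` for a finite set `S` of vectors in a full lattice and a geometrically finite group
`Γ` of isometries of that lattice. -/
def IsCrystallographic {N : ℕ} (J : Matrix (Fin N) (Fin N) ℝ) (D : Fin N → ℝ)
    (P : Set (Fin N → ℝ)) : Prop :=
  ∃ (b : Module.Basis (Fin N) ℝ (Fin N → ℝ))
    (Γ : Subgroup ((Fin N → ℝ) ≃ₗ[ℝ] (Fin N → ℝ))) (S : Set (Fin N → ℝ)),
    (∀ g ∈ Γ, IsLatticeIsometry J D (Submodule.span ℤ (Set.range b)) g) ∧
    IsGeometricallyFinite J D Γ ∧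
    S.Finite ∧ S ⊆ Submodule.span ℤ (Set.range b) ∧ P = orbit Γ S

/-- Two distinct spheres are tangent: `|v · w| = ‖v‖ ‖w‖`, where `‖v‖ = √(-v · v)`. -/
def Tangent {N : ℕ} (J : Matrix (Fin N) (Fin N) ℝ) (v w : Fin N → ℝ) : Prop :=
  LinearIndependent ℝ ![v, w] ∧
    |prod J v w| = Real.sqrt (-prod J v v) * Real.sqrt (-prod J w w)

/-- Every sphere is a member of a cluster of `N` mutually tangent spheres. -/
def HasApollonianProperty {N : ℕ} (J : Matrix (Fin N) (Fin N) ℝ) (P : Set (Fin N → ℝ)) : Prop :=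
  ∀ v ∈ P, ∃ C : Finset (Fin N → ℝ), (C : Set (Fin N → ℝ)) ⊆ P ∧ v ∈ C ∧ C.card = N ∧
    ∀ u ∈ C, ∀ w ∈ C, u ≠ w → Tangent J u w

/-- Apollonian packings in `ℝⁿ`. Being a sphere packing and being maximal are required in every
perspective. -/
structure IsApollonian (n : ℕ) {N : ℕ} (J : Matrix (Fin N) (Fin N) ℝ) (D : Fin N → ℝ)
    (P : Set (Fin N → ℝ)) : Prop where
  packing : IsPacking J P
  spherePacking : ∀ (E : Fin N → ℝ) (φ : EuclideanSpace ℝ (Fin n) → Fin N → ℝ),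
    IsPerspective J D E φ → IsSpherePacking J φ P
  crystallographic : IsCrystallographic J D P
  maximal : ∀ (E : Fin N → ℝ) (φ : EuclideanSpace ℝ (Fin n) → Fin N → ℝ),
    IsPerspective J D E φ → IsMaximal J φ P
  apollonian : HasApollonianProperty J P

/-! ### The Coxeter graph

The nodes `β₀, …, β₉` form the tree `T₂₄₆`: the path `β₁ - β₂ - ⋯ - β₉` with `β₀` joined to `β₄`.
All nodes have norm `-2`. -/

/-- The edges among `β₀, …, β₉`. -/
def edges : List (Fin 10 × Fin 10) :=
  [(0, 4), (1, 2), (2, 3), (3, 4), (4, 5), (5, 6), (6, 7), (7, 8), (8, 9)]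

/-- The Gram matrix `[βᵢ · βⱼ]`. -/
def Jβ : Matrix (Fin 10) (Fin 10) ℝ := Matrix.of fun i j =>
  if i = j then -2 else if (i, j) ∈ edges ∨ (j, i) ∈ edges then 1 else 0

/-- The nodes `βᵢ`, as the standard basis of the space on which `Jβ` is the Gram matrix. -/
def β (i : Fin 10) : Fin 10 → ℝ := Pi.single i 1

/-- `ν` is the eleventh node: of norm `-2`, joined to `β₉` by a bold edge (the two hyperplanes are
parallel, so the product is `2`) and to no other node. -/
def IsBoldNode (ν : Fin 10 → ℝ) : Prop :=
  prod Jβ ν ν = -2 ∧ prod Jβ ν (β 9) = 2 ∧ ∀ i, i ≠ 9 → prod Jβ ν (β i) = 0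

/-- The group generated by the reflections in `β₀, …, β₉`. -/
def Γβ : Subgroup ((Fin 10 → ℝ) ≃ₗ[ℝ] (Fin 10 → ℝ)) := weylGroup Jβ β

end Apollonian

end

namespace Apollonian

noncomputable section

/-! ### Bilinearity -/

section Bilinear

variable {N : ℕ} (J : Matrix (Fin N) (Fin N) ℝ) (u v w : Fin N → ℝ) (c : ℝ)

/-! Write x = ∑ xᵢ βᵢ. The nodes β₀, …, β₇ form an affine E₇ diagram with null root δ, and ν = δ −
β₉. Two facts drive everything: ν is dominant (βᵢ · ν ≥ 0 for all i), and ν · x = 2 x₉.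

Packing. By the Coxeter argument relating length to the sign of roots (`root_nonneg`), the orbit of
a dominant vector lies coordinatewise above it. A descent by reflections that fix x₉ then shows
(gν)₉ ≥ 1 unless gν = ν (`one_le_coord_nine`), hence v · w ≥ 2 for distinct members. So v + w is
causal, nonzero and future directed, which makes the spheres tangent or disjoint in every
perspective. The same root argument, with a minimization over an orbit of integral points, makes the
chamber βᵢ · x ≥ 0 a fundamental domain.

Maximality. In the part of the chamber where ν · x ≥ 0 all coordinates are nonnegative, so x · x = ∑
xᵢ (βᵢ · x) ≥ 0: this polyhedral cone does not leave the light cone. Moving vectors into the chamber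
shows that any vector nonnegative on the whole packing is causal (`prod_self_nonneg_of_forall`). A
ball in the residual set would have as pole a spacelike vector that is nonnegative on the packing.

Tangency. Reflecting ν successively in β₉, β₈, …, β₁ produces ten vectors with mutual products 2. -/

theorem prod_add_left : prod J (u + v) w = prod J u w + prod J v w := by
  simp [prod, add_dotProduct]

theorem prod_add_right : prod J w (u + v) = prod J w u + prod J w v := by
  simp [prod, Matrix.mulVec_add, dotProduct_add]

theorem prod_smul_left : prod J (c • u) w = c * prod J u w := by
  simp [prod, smul_dotProduct]

theorem prod_smul_right : prod J w (c • u) = c * prod J w u := by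
  simp [prod, Matrix.mulVec_smul, dotProduct_smul]

theorem prod_neg_left : prod J (-u) w = -prod J u w := by
  simp [prod, neg_dotProduct]

theorem prod_neg_right : prod J w (-u) = -prod J w u := by
  simp [prod, Matrix.mulVec_neg, dotProduct_neg]

theorem prod_sub_left : prod J (u - v) w = prod J u w - prod J v w := by
  simp [prod, sub_dotProduct]

theorem prod_sub_right : prod J w (u - v) = prod J w u - prod J w v := by
  simp [prod, Matrix.mulVec_sub, dotProduct_sub]

theorem prod_zero_left : prod J 0 w = 0 := by
  simp [prod]

theorem prod_zero_right : prod J w 0 = 0 := by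
  simp [prod]

theorem prod_sum_left {ι : Type*} (s : Finset ι) (f : ι → Fin N → ℝ) :
    prod J (∑ i ∈ s, f i) w = ∑ i ∈ s, prod J (f i) w := by
  simp [prod, sum_dotProduct]

theorem continuous_prod_self : Continuous fun x : Fin N → ℝ => prod J x x := by
  unfold prod
  fun_prop

end Bilinear

/-! ### The form of the tree in coordinates -/

theorem prod_Jβ (x y : Fin 10 → ℝ) : prod Jβ x y =
    x 0 * (y 4 - 2 * y 0) + x 1 * (y 2 - 2 * y 1) + x 2 * (y 1 + y 3 - 2 * y 2)
      + x 3 * (y 2 + y 4 - 2 * y 3) + x 4 * (y 0 + y 3 + y 5 - 2 * y 4)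
      + x 5 * (y 4 + y 6 - 2 * y 5) + x 6 * (y 5 + y 7 - 2 * y 6)
      + x 7 * (y 6 + y 8 - 2 * y 7) + x 8 * (y 7 + y 9 - 2 * y 8) + x 9 * (y 8 - 2 * y 9) := by
  simp only [prod, dotProduct, Matrix.mulVec, Jβ, Matrix.of_apply, edges, Fin.sum_univ_succ,
    Fin.succ_zero_eq_one, Fin.succ_one_eq_two, Fin.sum_univ_zero, Fin.reduceSucc, Fin.reduceEq,
    List.mem_cons, Prod.mk.injEq, List.not_mem_nil]
  norm_num
  ring

theorem prod_comm (x y : Fin 10 → ℝ) : prod Jβ x y = prod Jβ y x := by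
  rw [prod_Jβ, prod_Jβ]; ring

theorem prod_β_β (i j : Fin 10) : prod Jβ (β i) (β j) = Jβ i j := by
  simp [prod, β]

theorem prod_β_self (i : Fin 10) : prod Jβ (β i) (β i) = -2 := by
  rw [prod_β_β]; simp [Jβ]

theorem prod_β_of_ne {i j : Fin 10} (h : i ≠ j) :
    prod Jβ (β i) (β j) = 0 ∨ prod Jβ (β i) (β j) = 1 := by
  rw [prod_β_β]
  simp only [Jβ, Matrix.of_apply, h, if_false]
  split_ifs <;> simp

theorem prod_eq_sum (x y : Fin 10 → ℝ) : prod Jβ x y = ∑ i, x i * prod Jβ (β i) y := by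
  simp only [prod, β, single_one_dotProduct]
  rfl

theorem prod_β_left (x : Fin 10 → ℝ) :
    prod Jβ (β 0) x = x 4 - 2 * x 0 ∧ prod Jβ (β 1) x = x 2 - 2 * x 1 ∧
    prod Jβ (β 2) x = x 1 + x 3 - 2 * x 2 ∧ prod Jβ (β 3) x = x 2 + x 4 - 2 * x 3 ∧
    prod Jβ (β 4) x = x 0 + x 3 + x 5 - 2 * x 4 ∧ prod Jβ (β 5) x = x 4 + x 6 - 2 * x 5 ∧
    prod Jβ (β 6) x = x 5 + x 7 - 2 * x 6 ∧ prod Jβ (β 7) x = x 6 + x 8 - 2 * x 7 ∧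
    prod Jβ (β 8) x = x 7 + x 9 - 2 * x 8 ∧ prod Jβ (β 9) x = x 8 - 2 * x 9 := by
  simp [prod_Jβ, β]

/-- Coordinates other than the last are nonnegative combinations of the products with the nodes. -/
theorem coord_nonneg_of_dominant {x : Fin 10 → ℝ} (h : ∀ i, 0 ≤ prod Jβ (β i) x) :
    0 ≤ x 0 ∧ 0 ≤ x 1 ∧ 0 ≤ x 2 ∧ 0 ≤ x 3 ∧ 0 ≤ x 4 ∧ 0 ≤ x 5 ∧ 0 ≤ x 6 ∧ 0 ≤ x 7 ∧ 0 ≤ x 8 := by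
  obtain ⟨e0, e1, e2, e3, e4, e5, e6, e7, e8, e9⟩ := prod_β_left x
  have h0 := h 0
  have h1 := h 1
  have h2 := h 2
  have h3 := h 3
  have h4 := h 4
  have h5 := h 5
  have h6 := h 6
  have h7 := h 7
  have h8 := h 8
  have h9 := h 9
  rw [e0] at h0
  rw [e1] at h1
  rw [e2] at h2
  rw [e3] at h3
  rw [e4] at h4
  rw [e5] at h5
  rw [e6] at h6
  rw [e7] at h7
  rw [e8] at h8
  rw [e9] at h9
  refine ⟨?_, ?_, ?_, ?_, ?_, ?_, ?_, ?_, ?_⟩ <;> linarith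

theorem coord_four_pos_of_dominant {x : Fin 10 → ℝ} (h : ∀ i, 0 < prod Jβ (β i) x) :
    0 < x 4 := by
  obtain ⟨h0, -, -, -, -⟩ := coord_nonneg_of_dominant fun i => (h i).le
  have := h 0
  rw [(prod_β_left x).1] at this
  linarith

/-- The form as a sum of squares. -/
theorem prod_self_eq (x : Fin 10 → ℝ) : prod Jβ x x =
    1 / 12 * x 4 ^ 2 - (2 * (x 0 - 1 / 2 * x 4) ^ 2 + 2 * (x 1 - 1 / 2 * x 2) ^ 2
      + 3 / 2 * (x 2 - 2 / 3 * x 3) ^ 2 + 4 / 3 * (x 3 - 3 / 4 * x 4) ^ 2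
      + 2 * (x 9 - 1 / 2 * x 8) ^ 2 + 3 / 2 * (x 8 - 2 / 3 * x 7) ^ 2
      + 4 / 3 * (x 7 - 3 / 4 * x 6) ^ 2 + 5 / 4 * (x 6 - 4 / 5 * x 5) ^ 2
      + 6 / 5 * (x 5 - 5 / 6 * x 4) ^ 2) := by
  rw [prod_Jβ]; ring

/-- The coordinates of a causal vector are bounded by the fourth one. -/
theorem abs_coord_le {x : Fin 10 → ℝ} (hx : 0 ≤ prod Jβ x x) (i : Fin 10) :
    |x i| ≤ 7 * |x 4| := by
  rw [prod_self_eq] at hx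
  -- Every square in `prod_self_eq` has coefficient at least 1 > 1/12, so each difference is at most
  -- |x 4| in absolute value. Chaining outwards from node 4 bounds all coordinates; the constant 7
  -- is generous.
  have key (a : ℝ) (h : a ^ 2 ≤ x 4 ^ 2) : |a| ≤ |x 4| := sq_le_sq.mp h
  have q0 := sq_nonneg (x 0 - 1 / 2 * x 4)
  have q1 := sq_nonneg (x 1 - 1 / 2 * x 2)
  have q2 := sq_nonneg (x 2 - 2 / 3 * x 3)
  have q3 := sq_nonneg (x 3 - 3 / 4 * x 4)
  have q4 := sq_nonneg (x 9 - 1 / 2 * x 8)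
  have q5 := sq_nonneg (x 8 - 2 / 3 * x 7)
  have q6 := sq_nonneg (x 7 - 3 / 4 * x 6)
  have q7 := sq_nonneg (x 6 - 4 / 5 * x 5)
  have q8 := sq_nonneg (x 5 - 5 / 6 * x 4)
  have q := sq_nonneg (x 4)
  obtain ⟨a0, b0⟩ := abs_le.mp (key (x 0 - 1 / 2 * x 4) (by linarith))
  obtain ⟨a1, b1⟩ := abs_le.mp (key (x 1 - 1 / 2 * x 2) (by linarith))
  obtain ⟨a2, b2⟩ := abs_le.mp (key (x 2 - 2 / 3 * x 3) (by linarith))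
  obtain ⟨a3, b3⟩ := abs_le.mp (key (x 3 - 3 / 4 * x 4) (by linarith))
  obtain ⟨a4, b4⟩ := abs_le.mp (key (x 9 - 1 / 2 * x 8) (by linarith))
  obtain ⟨a5, b5⟩ := abs_le.mp (key (x 8 - 2 / 3 * x 7) (by linarith))
  obtain ⟨a6, b6⟩ := abs_le.mp (key (x 7 - 3 / 4 * x 6) (by linarith))
  obtain ⟨a7, b7⟩ := abs_le.mp (key (x 6 - 4 / 5 * x 5) (by linarith))
  obtain ⟨a8, b8⟩ := abs_le.mp (key (x 5 - 5 / 6 * x 4) (by linarith))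
  obtain ⟨a9, b9⟩ := abs_le.mp (le_refl |x 4|)
  rw [abs_le]
  fin_cases i <;> constructor <;> simp only [Fin.reduceFinMk, Fin.zero_eta, Fin.mk_one] <;> linarith

/-! ### Lorentzian geometry -/

theorem eq_zero_of_coord_four_eq_zero {x : Fin 10 → ℝ} (h4 : x 4 = 0) (hx : 0 ≤ prod Jβ x x) :
    x = 0 := by
  ext i
  have := abs_coord_le hx i
  rw [h4, abs_zero, mul_zero] at this
  exact abs_nonpos_iff.mp this

theorem prod_self_nonpos_of_coord_four_eq_zero {x : Fin 10 → ℝ} (h4 : x 4 = 0) :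
    prod Jβ x x ≤ 0 := by
  by_contra! h
  rw [eq_zero_of_coord_four_eq_zero h4 h.le, prod_zero_left] at h
  exact lt_irrefl _ h

/-- The combination y₄ x − x₄ y lies in the hyperplane of vanishing fourth coordinate, where the
form is nonpositive. With this inequality the sign of the fourth coordinate serves as time
orientation. -/
theorem reversed_cauchy_schwarz (x y : Fin 10 → ℝ) :
    y 4 ^ 2 * prod Jβ x x + x 4 ^ 2 * prod Jβ y y ≤ 2 * (x 4 * y 4 * prod Jβ x y) := by
  have h := prod_self_nonpos_of_coord_four_eq_zero (x := y 4 • x - x 4 • y)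
    (by simp [mul_comm])
  simp only [prod_sub_left, prod_sub_right, prod_smul_left, prod_smul_right, prod_comm y x] at h
  linarith

theorem prod_nonneg_of_causal {x y : Fin 10 → ℝ} (hx : 0 ≤ prod Jβ x x) (hy : 0 ≤ prod Jβ y y)
    (hx4 : 0 < x 4) (hy4 : 0 < y 4) : 0 ≤ prod Jβ x y := by
  have h := reversed_cauchy_schwarz x y
  have h' : 0 ≤ x 4 * y 4 * prod Jβ x y := by
    nlinarith [mul_nonneg (sq_nonneg (y 4)) hx, mul_nonneg (sq_nonneg (x 4)) hy]
  exact nonneg_of_mul_nonneg_right h' (mul_pos hx4 hy4)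

theorem prod_pos_of_timelike {x y : Fin 10 → ℝ} (hx : 0 < prod Jβ x x) (hy : 0 ≤ prod Jβ y y)
    (hx4 : 0 < x 4) (hy4 : 0 < y 4) : 0 < prod Jβ x y := by
  have h := reversed_cauchy_schwarz x y
  have h' : 0 < x 4 * y 4 * prod Jβ x y := by
    nlinarith [mul_pos (pow_pos hy4 2) hx, mul_nonneg (sq_nonneg (x 4)) hy]
  exact pos_of_mul_pos_right h' (mul_pos hx4 hy4).le

theorem coord_four_pos_of_prod_pos {x y : Fin 10 → ℝ} (hx : 0 ≤ prod Jβ x x)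
    (hy : 0 ≤ prod Jβ y y) (hx4 : 0 < x 4) (h : 0 < prod Jβ x y) : 0 < y 4 := by
  by_contra! hy4
  rcases hy4.lt_or_eq with hlt | heq
  · have := prod_nonneg_of_causal (y := -y) hx (by simpa [prod_neg_left, prod_neg_right] using hy)
      hx4 (by simpa using hlt)
    rw [prod_neg_right] at this
    linarith
  · rw [eq_zero_of_coord_four_eq_zero heq hy, prod_zero_right] at h
    exact lt_irrefl _ h

theorem eq_zero_of_prod_timelike_eq_zero {x v : Fin 10 → ℝ} (hx : 0 < prod Jβ x x)
    (hxv : prod Jβ x v = 0) (hv : 0 ≤ prod Jβ v v) : v = 0 := by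
  have h := reversed_cauchy_schwarz x v
  rw [hxv] at h
  have h4 : v 4 = 0 := by
    have : v 4 ^ 2 * prod Jβ x x ≤ 0 := by nlinarith [mul_nonneg (sq_nonneg (x 4)) hv]
    exact pow_eq_zero_iff two_ne_zero |>.mp
      (le_antisymm (nonpos_of_mul_nonpos_left this hx) (sq_nonneg _))
  exact eq_zero_of_coord_four_eq_zero h4 hv

theorem eq_smul_of_null {x y : Fin 10 → ℝ} (hx : prod Jβ x x = 0) (hy : prod Jβ y y = 0)
    (hy4 : 0 < y 4) (h : prod Jβ x y = 0) : x = (x 4 / y 4) • y := by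
  have hz := eq_zero_of_coord_four_eq_zero (x := x - (x 4 / y 4) • y)
    (by simp [hy4.ne'])
    (by simp [prod_sub_left, prod_sub_right, prod_smul_left, prod_smul_right, prod_comm y x,
          hx, hy, h])
  exact sub_eq_zero.mp hz

/-! ### The reflections in the nodes -/

theorem reflect_β (i : Fin 10) (x : Fin 10 → ℝ) :
    reflect Jβ (β i) x = x + prod Jβ (β i) x • β i := by
  rw [reflect, prod_β_self, sub_eq_add_neg, ← neg_smul]
  congr 2
  ring

/-- The reflection in the node `β i`. -/
def refl (i : Fin 10) : (Fin 10 → ℝ) ≃ₗ[ℝ] (Fin 10 → ℝ) :=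
  LinearEquiv.ofInvolutive
    { toFun := fun x => x + prod Jβ (β i) x • β i
      map_add' := fun x y => by rw [prod_add_right, add_smul]; abel
      map_smul' := fun c x => by rw [prod_smul_right, mul_smul, RingHom.id_apply, smul_add] }
    (fun x => by
      simp only [LinearMap.coe_mk, AddHom.coe_mk, prod_add_right, prod_smul_right, prod_β_self]
      module)

theorem refl_apply (i : Fin 10) (x : Fin 10 → ℝ) : refl i x = x + prod Jβ (β i) x • β i := rfl

theorem refl_β (i : Fin 10) : refl i (β i) = -β i := by
  rw [refl_apply, prod_β_self]; module

theorem refl_refl (i : Fin 10) (x : Fin 10 → ℝ) : refl i (refl i x) = x :=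
  (refl i).left_inv x

theorem refl_mul_self (i : Fin 10) : refl i * refl i = 1 :=
  LinearEquiv.ext (refl_refl i)

theorem prod_refl_left (i : Fin 10) (x y : Fin 10 → ℝ) :
    prod Jβ (refl i x) y = prod Jβ x y + prod Jβ (β i) x * prod Jβ (β i) y := by
  rw [refl_apply, prod_add_left, prod_smul_left]

theorem prod_refl_refl (i : Fin 10) (x y : Fin 10 → ℝ) :
    prod Jβ (refl i x) (refl i y) = prod Jβ x y := by
  simp only [refl_apply, prod_add_left, prod_add_right, prod_smul_left, prod_smul_right,
    prod_β_self, prod_comm x (β i)]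
  ring

theorem Γβ_eq_closure : Γβ = Subgroup.closure (Set.range refl) := by
  unfold Γβ weylGroup
  congr 1
  ext g
  constructor
  · rintro ⟨i, hi⟩
    exact ⟨i, LinearEquiv.ext fun x => by rw [hi, reflect_β, refl_apply]⟩
  · rintro ⟨i, rfl⟩
    exact ⟨i, fun x => by rw [reflect_β, refl_apply]⟩

theorem refl_mem (i : Fin 10) : refl i ∈ Γβ := by
  rw [Γβ_eq_closure]
  exact Subgroup.subset_closure ⟨i, rfl⟩

/-- A property of vectors preserved by the reflections is preserved by the group. -/
theorem Γβ_induction {p : (Fin 10 → ℝ) → Prop} (h : ∀ i x, p x → p (refl i x))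
    {g : (Fin 10 → ℝ) ≃ₗ[ℝ] (Fin 10 → ℝ)} (hg : g ∈ Γβ) : ∀ x, p x → p (g x) := by
  rw [Γβ_eq_closure] at hg
  induction hg using Subgroup.closure_induction'' with
  | mem _ hx => obtain ⟨i, rfl⟩ := hx; exact h i
  | inv_mem _ hx =>
    obtain ⟨i, rfl⟩ := hx
    rw [inv_eq_of_mul_eq_one_right (refl_mul_self i)]
    exact h i
  | one => exact fun _ hx => hx
  | mul _ _ _ _ h₁ h₂ => exact fun x hx => h₁ _ (h₂ x hx)

theorem prod_map_map {g : (Fin 10 → ℝ) ≃ₗ[ℝ] (Fin 10 → ℝ)} (hg : g ∈ Γβ) (x y : Fin 10 → ℝ) :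
    prod Jβ (g x) (g y) = prod Jβ x y := by
  rw [Γβ_eq_closure] at hg
  induction hg using Subgroup.closure_induction'' generalizing x y with
  | mem _ hx => obtain ⟨i, rfl⟩ := hx; exact prod_refl_refl i x y
  | inv_mem _ hx =>
    obtain ⟨i, rfl⟩ := hx
    rw [inv_eq_of_mul_eq_one_right (refl_mul_self i)]
    exact prod_refl_refl i x y
  | one => rfl
  | mul a b _ _ h₁ h₂ => exact (h₁ (b x) (b y)).trans (h₂ x y)

theorem prod_map_left {g : (Fin 10 → ℝ) ≃ₗ[ℝ] (Fin 10 → ℝ)} (hg : g ∈ Γβ) (x y : Fin 10 → ℝ) :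
    prod Jβ (g x) y = prod Jβ x (g⁻¹ y) := by
  rw [← prod_map_map hg x (g⁻¹ y)]
  congr 1
  exact (g.apply_symm_apply y).symm

theorem coord_four_map_pos {g : (Fin 10 → ℝ) ≃ₗ[ℝ] (Fin 10 → ℝ)} (hg : g ∈ Γβ)
    {x : Fin 10 → ℝ} (hx : 0 < prod Jβ x x) (hx4 : 0 < x 4) : 0 < g x 4 := by
  refine (Γβ_induction (p := fun x => 0 < prod Jβ x x ∧ 0 < x 4) ?_ hg x ⟨hx, hx4⟩).2
  rintro i x ⟨hx, hx4⟩
  have h : 0 < prod Jβ (refl i x) (refl i x) := by rwa [prod_refl_refl]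
  refine ⟨h, coord_four_pos_of_prod_pos hx.le h.le hx4 ?_⟩
  rw [prod_comm, prod_refl_left]
  nlinarith [mul_self_nonneg (prod Jβ (β i) x)]

/-- Vectors with integral coordinates. -/
def IsIntegral (x : Fin 10 → ℝ) : Prop := ∀ i, ∃ z : ℤ, x i = z

theorem isIntegral_β (i : Fin 10) : IsIntegral (β i) := fun j =>
  ⟨if j = i then 1 else 0, by simp [β, Pi.single_apply]⟩

theorem IsIntegral.exists_prod {x y : Fin 10 → ℝ} (hx : IsIntegral x) (hy : IsIntegral y) :
    ∃ z : ℤ, prod Jβ x y = z := by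
  choose a ha using hx
  choose b hb using hy
  exact ⟨a 0 * (b 4 - 2 * b 0) + a 1 * (b 2 - 2 * b 1) + a 2 * (b 1 + b 3 - 2 * b 2)
    + a 3 * (b 2 + b 4 - 2 * b 3) + a 4 * (b 0 + b 3 + b 5 - 2 * b 4)
    + a 5 * (b 4 + b 6 - 2 * b 5) + a 6 * (b 5 + b 7 - 2 * b 6)
    + a 7 * (b 6 + b 8 - 2 * b 7) + a 8 * (b 7 + b 9 - 2 * b 8) + a 9 * (b 8 - 2 * b 9), by
    rw [prod_Jβ]
    simp only [ha, hb]
    push_cast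
    ring⟩

theorem IsIntegral.map {g : (Fin 10 → ℝ) ≃ₗ[ℝ] (Fin 10 → ℝ)} (hg : g ∈ Γβ) {x : Fin 10 → ℝ}
    (hx : IsIntegral x) : IsIntegral (g x) := by
  refine Γβ_induction (p := IsIntegral) (fun i x hx j => ?_) hg x hx
  obtain ⟨z, hz⟩ := (isIntegral_β i).exists_prod hx
  obtain ⟨a, ha⟩ := hx j
  obtain ⟨b, hb⟩ := isIntegral_β i j
  exact ⟨a + z * b, by simp [refl_apply, hz, ha, hb]⟩

/-! ### Length and the sign of roots -/

/-- The product of the reflections listed in a word. -/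
def word (l : List (Fin 10)) : (Fin 10 → ℝ) ≃ₗ[ℝ] (Fin 10 → ℝ) := (l.map refl).prod

theorem word_append (l : List (Fin 10)) (i : Fin 10) : word (l ++ [i]) = word l * refl i := by
  simp [word]

theorem exists_word {g : (Fin 10 → ℝ) ≃ₗ[ℝ] (Fin 10 → ℝ)} (hg : g ∈ Γβ) :
    ∃ l, word l = g := by
  rw [Γβ_eq_closure] at hg
  induction hg using Subgroup.closure_induction'' with
  | mem _ hx => obtain ⟨i, rfl⟩ := hx; exact ⟨[i], by simp [word]⟩
  | inv_mem _ hx =>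
    obtain ⟨i, rfl⟩ := hx
    exact ⟨[i], by simp [word, inv_eq_of_mul_eq_one_right (refl_mul_self i)]⟩
  | one => exact ⟨[], rfl⟩
  | mul _ _ _ _ h₁ h₂ =>
    obtain ⟨l₁, rfl⟩ := h₁
    obtain ⟨l₂, rfl⟩ := h₂
    exact ⟨l₁ ++ l₂, by simp [word]⟩

/-- The length of the shortest word for a group element. -/
def len (g : (Fin 10 → ℝ) ≃ₗ[ℝ] (Fin 10 → ℝ)) : ℕ := sInf {n | ∃ l, l.length = n ∧ word l = g}

theorem len_word_le (l : List (Fin 10)) : len (word l) ≤ l.length := Nat.sInf_le ⟨l, rfl, rfl⟩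

theorem exists_reduced_word {g : (Fin 10 → ℝ) ≃ₗ[ℝ] (Fin 10 → ℝ)} (hg : g ∈ Γβ) :
    ∃ l, l.length = len g ∧ word l = g := by
  obtain ⟨l, hl⟩ := exists_word hg
  exact Nat.sInf_mem (s := {n | ∃ l, l.length = n ∧ word l = g}) ⟨_, l, rfl, hl⟩

theorem len_mul_refl_le {g : (Fin 10 → ℝ) ≃ₗ[ℝ] (Fin 10 → ℝ)} (hg : g ∈ Γβ) (i : Fin 10) :
    len (g * refl i) ≤ len g + 1 := by
  obtain ⟨l, hl, rfl⟩ := exists_reduced_word hg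
  rw [← word_append, ← hl]
  simpa using len_word_le (l ++ [i])

theorem mul_refl_mul_refl (g : (Fin 10 → ℝ) ≃ₗ[ℝ] (Fin 10 → ℝ)) (i : Fin 10) :
    g * refl i * refl i = g := by
  rw [mul_assoc, refl_mul_self, mul_one]

theorem exists_descent {g : (Fin 10 → ℝ) ≃ₗ[ℝ] (Fin 10 → ℝ)} (hg : g ∈ Γβ) (h1 : g ≠ 1) :
    ∃ j, len (g * refl j) < len g := by
  obtain ⟨l, hl, rfl⟩ := exists_reduced_word hg
  rcases List.eq_nil_or_concat l with rfl | ⟨l', j, rfl⟩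
  · exact absurd rfl h1
  · refine ⟨j, ?_⟩
    rw [← hl, List.concat_eq_append, word_append, mul_refl_mul_refl, List.length_append]
    exact Nat.lt_succ_of_le (len_word_le l')

theorem refl_mul_comm {i j : Fin 10} (h : prod Jβ (β i) (β j) = 0) :
    refl i * refl j = refl j * refl i := by
  have h' : prod Jβ (β j) (β i) = 0 := by rw [prod_comm, h]
  ext1 x
  simp only [LinearEquiv.mul_apply, refl_apply, prod_add_right, prod_smul_right, h, h']
  module

theorem refl_braid {i j : Fin 10} (h : prod Jβ (β i) (β j) = 1) :
    refl i * refl j * refl i = refl j * refl i * refl j := by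
  have h' : prod Jβ (β j) (β i) = 1 := by rw [prod_comm, h]
  ext1 x
  simp only [LinearEquiv.mul_apply, refl_apply, prod_add_right, prod_smul_right, h, h',
    prod_β_self]
  module

/-- If `g sᵢ` is not shorter than `g`, then the root `g βᵢ` is positive. -/
theorem root_nonneg {g : (Fin 10 → ℝ) ≃ₗ[ℝ] (Fin 10 → ℝ)} (hg : g ∈ Γβ) {i : Fin 10}
    (hi : len g ≤ len (g * refl i)) : 0 ≤ g (β i) := by
  induction hn : len g using Nat.strong_induction_on generalizing g i with
  | _ n ih =>
    subst hn
    by_cases h1 : g = 1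
    · subst h1
      exact Pi.single_nonneg.mpr zero_le_one
    obtain ⟨j, hj⟩ := exists_descent hg h1
    have hij : j ≠ i := by
      rintro rfl
      omega
    obtain ⟨w, rfl⟩ : ∃ w, g = w * refl j := ⟨g * refl j, (mul_refl_mul_refl g j).symm⟩
    rw [mul_refl_mul_refl] at hj
    have hw : w ∈ Γβ := by
      have := mul_mem hg (refl_mem j)
      rwa [mul_refl_mul_refl] at this
    -- The diagram has only the relations of order 2 and 3. If sᵢ and sⱼ commute, then g βᵢ = w βᵢ,
    -- and shortening w by sᵢ would shorten g by sᵢ too.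
    rcases prod_β_of_ne hij with h | h
    · have hβ : (w * refl j) (β i) = w (β i) := by
        rw [LinearEquiv.mul_apply, refl_apply, h, zero_smul, add_zero]
      rw [hβ]
      refine ih _ hj hw ?_ rfl
      by_contra! hlt
      have h2 := len_mul_refl_le (mul_mem hw (refl_mem i)) j
      rw [mul_assoc, ← refl_mul_comm h, ← mul_assoc] at h2
      omega
    · have hβ : (w * refl j) (β i) = w (β i) + w (β j) := by
        rw [LinearEquiv.mul_apply, refl_apply, h, one_smul, map_add]
      by_cases hwi : len w ≤ len (w * refl i)
      · rw [hβ]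
        exact add_nonneg (ih _ hj hw hwi rfl) (ih _ hj hw hj.le rfl)
      -- Now g = u sᵢ sⱼ and g βᵢ = u βⱼ. If sⱼ shortened u, the braid relation g sᵢ = u sⱼ sᵢ sⱼ
      -- would give g sᵢ length at most len u + 1, less than len g.
      · push Not at hwi
        obtain ⟨u, rfl⟩ : ∃ u, w = u * refl i := ⟨w * refl i, (mul_refl_mul_refl w i).symm⟩
        rw [mul_refl_mul_refl] at hwi
        have hu : u ∈ Γβ := by
          have := mul_mem hw (refl_mem i)
          rwa [mul_refl_mul_refl] at this
        have hβ' : (u * refl i * refl j) (β i) = u (β j) := by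
          rw [hβ, LinearEquiv.mul_apply, LinearEquiv.mul_apply, refl_β, refl_apply, prod_comm, h,
            one_smul, map_add, map_neg]
          abel
        rw [hβ']
        refine ih _ (hwi.trans hj) hu ?_ rfl
        by_contra! hlt
        have h2 := len_mul_refl_le (mul_mem hu (refl_mem j)) i
        have h3 := len_mul_refl_le (mul_mem (mul_mem hu (refl_mem j)) (refl_mem i)) j
        have hb : u * refl j * refl i * refl j = u * refl i * refl j * refl i := by
          have := congrArg (u * ·) (refl_braid h)
          simpa only [mul_assoc] using this
        rw [hb] at h3
        omega

/-- The orbit of a dominant vector lies above that vector. -/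
theorem le_map_of_dominant {g : (Fin 10 → ℝ) ≃ₗ[ℝ] (Fin 10 → ℝ)} (hg : g ∈ Γβ)
    {x : Fin 10 → ℝ} (hx : ∀ i, 0 ≤ prod Jβ (β i) x) : x ≤ g x := by
  induction hn : len g using Nat.strong_induction_on generalizing g with
  | _ n ih =>
    subst hn
    by_cases h1 : g = 1
    · subst h1
      exact le_refl _
    obtain ⟨j, hj⟩ := exists_descent hg h1
    obtain ⟨w, rfl⟩ : ∃ w, g = w * refl j := ⟨g * refl j, (mul_refl_mul_refl g j).symm⟩
    rw [mul_refl_mul_refl] at hj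
    have hw : w ∈ Γβ := by
      have := mul_mem hg (refl_mem j)
      rwa [mul_refl_mul_refl] at this
    rw [LinearEquiv.mul_apply, refl_apply, map_add, map_smul]
    exact le_add_of_le_of_nonneg (ih _ hj hw rfl) (smul_nonneg (hx j) (root_nonneg hw hj.le))

/-- A dominant vector is the only dominant one in its orbit. -/
theorem map_eq_of_dominant {g : (Fin 10 → ℝ) ≃ₗ[ℝ] (Fin 10 → ℝ)} (hg : g ∈ Γβ)
    {x : Fin 10 → ℝ} (hx : ∀ i, 0 ≤ prod Jβ (β i) x) (hgx : ∀ i, 0 ≤ prod Jβ (β i) (g x)) :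
    g x = x := by
  refine le_antisymm ?_ (le_map_of_dominant hg hx)
  have h := le_map_of_dominant (inv_mem hg) hgx
  rwa [show g⁻¹ (g x) = x from g.symm_apply_apply x] at h

/-- Only the identity maps a point of the open chamber into the open chamber. -/
theorem eq_one_of_strictly_dominant {g : (Fin 10 → ℝ) ≃ₗ[ℝ] (Fin 10 → ℝ)} (hg : g ∈ Γβ)
    {x : Fin 10 → ℝ} (hx : ∀ i, 0 < prod Jβ (β i) x) (hgx : ∀ i, 0 < prod Jβ (β i) (g x)) :
    g = 1 := by
  by_contra h1
  obtain ⟨j, hj⟩ := exists_descent hg h1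
  -- A last letter j of g makes g βⱼ ≤ 0, so its product with the dominant g x is nonpositive,
  -- although it equals βⱼ · x > 0.
  have hr := root_nonneg (mul_mem hg (refl_mem j)) (i := j) (by rw [mul_refl_mul_refl]; exact hj.le)
  rw [LinearEquiv.mul_apply, refl_β, map_neg] at hr
  have h2 : 0 ≤ prod Jβ (-g (β j)) (g x) := by
    rw [prod_eq_sum]
    exact Finset.sum_nonneg fun i _ => mul_nonneg (hr i) (hgx i).le
  rw [prod_neg_left, prod_map_map hg] at h2
  linarith [hx j]

/-! ### The orbit of the bold node -/

/-- The coordinates of the bold node. -/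
def boldNode : Fin 10 → ℝ := ![2, 1, 2, 3, 4, 3, 2, 1, 0, -1]

theorem IsBoldNode.eq_boldNode {ν : Fin 10 → ℝ} (h : IsBoldNode ν) : ν = boldNode := by
  obtain ⟨-, h9, h⟩ := h
  have h' (i : Fin 10) (hi : i ≠ 9) : prod Jβ (β i) ν = 0 := by rw [prod_comm]; exact h i hi
  rw [prod_comm] at h9
  obtain ⟨e0, e1, e2, e3, e4, e5, e6, e7, e8, e9⟩ := prod_β_left ν
  rw [h' _ (by decide)] at e0 e1 e2 e3 e4 e5 e6 e7 e8
  rw [h9] at e9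
  ext i
  fin_cases i <;> simp [boldNode] <;> linarith

theorem prod_boldNode_left (x : Fin 10 → ℝ) : prod Jβ boldNode x = 2 * x 9 := by
  simp [prod_Jβ, boldNode]
  ring

theorem prod_boldNode_self : prod Jβ boldNode boldNode = -2 := by
  rw [prod_boldNode_left]; simp [boldNode]

theorem prod_β_boldNode (i : Fin 10) : prod Jβ (β i) boldNode = if i = 9 then 2 else 0 := by
  rw [prod_comm, prod_boldNode_left]
  simp [β, Pi.single_apply, eq_comm]

theorem boldNode_dominant (i : Fin 10) : 0 ≤ prod Jβ (β i) boldNode := by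
  rw [prod_β_boldNode]
  split_ifs <;> norm_num

theorem isIntegral_boldNode : IsIntegral boldNode := fun i =>
  ⟨(![2, 1, 2, 3, 4, 3, 2, 1, 0, -1] : Fin 10 → ℤ) i, by fin_cases i <;> simp [boldNode]⟩

theorem refl_boldNode {i : Fin 10} (hi : i ≠ 9) : refl i boldNode = boldNode := by
  rw [refl_apply, prod_β_boldNode, if_neg hi, zero_smul, add_zero]

/-- Reflections in β₀, …, β₈ fix both ν and the ninth coordinate, so g ν may be lowered by them
until it is dominant for these nine nodes. Were the ninth coordinate still below 1, the vector would
be dominant for β₉ as well and thus equal to ν. -/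
theorem one_le_coord_nine {g : (Fin 10 → ℝ) ≃ₗ[ℝ] (Fin 10 → ℝ)} (hg : g ∈ Γβ)
    (hne : g boldNode ≠ boldNode) : 1 ≤ g boldNode 9 := by
  -- The height of g ν above ν is a natural number, the quantity on which the descent runs.
  have hn (g : (Fin 10 → ℝ) ≃ₗ[ℝ] (Fin 10 → ℝ)) (hg : g ∈ Γβ) :
      ∃ n : ℕ, ∑ i, (g boldNode i - boldNode i) = n := by
    choose a ha using isIntegral_boldNode.map hg
    choose b hb using isIntegral_boldNode
    have h0 : 0 ≤ ∑ i, (g boldNode i - boldNode i) :=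
      Finset.sum_nonneg fun i _ => sub_nonneg.mpr (le_map_of_dominant hg boldNode_dominant i)
    simp only [ha, hb] at h0 ⊢
    norm_cast at h0
    obtain ⟨n, hn⟩ := Int.eq_ofNat_of_zero_le h0
    exact ⟨n, by exact_mod_cast hn⟩
  obtain ⟨n, h⟩ := hn g hg
  induction n using Nat.strong_induction_on generalizing g with
  | _ n ih =>
    by_cases hdom : ∃ i, i ≠ 9 ∧ prod Jβ (β i) (g boldNode) < 0
    · obtain ⟨i, hi, hlt⟩ := hdom
      have hg' := mul_mem (refl_mem i) hg
      obtain ⟨m, hm⟩ := hn _ hg'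
      have h9 : (refl i * g) boldNode 9 = g boldNode 9 := by
        simp [LinearEquiv.mul_apply, refl_apply, β, hi.symm]
      rw [← h9]
      refine ih m ?_ hg' (fun heq => hne ?_) hm
      · have : (m : ℝ) = n + prod Jβ (β i) (g boldNode) := by
          rw [← hm, ← h]
          simp only [LinearEquiv.mul_apply, refl_apply, Pi.add_apply, Pi.smul_apply, smul_eq_mul,
            Finset.sum_sub_distrib, Finset.sum_add_distrib, ← Finset.mul_sum]
          rw [show ∑ j, β i j = 1 by simp [β]]
          ring
        have : (m : ℝ) < n := by linarith
        exact_mod_cast this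
      · rw [LinearEquiv.mul_apply] at heq
        rw [← refl_refl i (g boldNode), heq, refl_boldNode hi]
    · push Not at hdom
      by_contra! hlt
      refine hne (map_eq_of_dominant hg boldNode_dominant fun i => ?_)
      rcases eq_or_ne i 9 with rfl | hi
      · have h8 := le_map_of_dominant hg boldNode_dominant 8
        have hb8 : boldNode 8 = 0 := rfl
        obtain ⟨z, hz⟩ := isIntegral_boldNode.map hg 9
        have : g boldNode 9 ≤ 0 := by
          rw [hz] at hlt ⊢
          exact_mod_cast Int.lt_add_one_iff.mp (by exact_mod_cast hlt)
        rw [(prod_β_left _).2.2.2.2.2.2.2.2.2]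
        linarith
      · exact hdom i hi

/-- The packing. -/
abbrev packing : Set (Fin 10 → ℝ) := orbit Γβ {boldNode}

theorem mem_packing {v : Fin 10 → ℝ} : v ∈ packing ↔ ∃ g ∈ Γβ, v = g boldNode := by
  simp [packing, orbit]

theorem boldNode_mem : boldNode ∈ packing := mem_packing.mpr ⟨1, one_mem _, rfl⟩

theorem map_mem_packing {g : (Fin 10 → ℝ) ≃ₗ[ℝ] (Fin 10 → ℝ)} (hg : g ∈ Γβ) {v : Fin 10 → ℝ}
    (hv : v ∈ packing) : g v ∈ packing := by
  obtain ⟨h, hh, rfl⟩ := mem_packing.mp hv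
  exact mem_packing.mpr ⟨g * h, mul_mem hg hh, rfl⟩

theorem prod_self_of_mem {v : Fin 10 → ℝ} (hv : v ∈ packing) : prod Jβ v v = -2 := by
  obtain ⟨g, hg, rfl⟩ := mem_packing.mp hv
  rw [prod_map_map hg, prod_boldNode_self]

/-- By invariance one of the two members may be taken to be ν, and ν · w = 2 w₉. -/
theorem two_le_prod {v w : Fin 10 → ℝ} (hv : v ∈ packing) (hw : w ∈ packing) (h : v ≠ w) :
    2 ≤ prod Jβ v w := by
  obtain ⟨a, ha, rfl⟩ := mem_packing.mp hv
  obtain ⟨b, hb, rfl⟩ := mem_packing.mp hw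
  rw [prod_map_left ha, ← LinearEquiv.mul_apply, prod_boldNode_left]
  have := one_le_coord_nine (mul_mem (inv_mem ha) hb) fun heq => h ?_
  · linarith
  · conv_lhs => rw [← heq]
    exact a.apply_symm_apply (b boldNode)

/-- A point of the chamber on the positive side of `boldNode` is on the positive side of every
member of the packing. -/
theorem prod_nonneg_of_mem {v x : Fin 10 → ℝ} (hv : v ∈ packing)
    (hx : ∀ i, 0 ≤ prod Jβ (β i) x) (h9 : 0 ≤ x 9) : 0 ≤ prod Jβ v x := by
  obtain ⟨g, hg, rfl⟩ := mem_packing.mp hv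
  have h : 0 ≤ prod Jβ (g boldNode - boldNode) x := by
    rw [prod_eq_sum]
    exact Finset.sum_nonneg fun i _ =>
      mul_nonneg (sub_nonneg.mpr (le_map_of_dominant hg boldNode_dominant i)) (hx i)
  rw [prod_sub_left, prod_boldNode_left] at h
  linarith

/-- The chamber on the positive side of `boldNode` consists of causal vectors. -/
theorem prod_self_nonneg_of_dominant {x : Fin 10 → ℝ} (hx : ∀ i, 0 ≤ prod Jβ (β i) x)
    (h9 : 0 ≤ x 9) : 0 ≤ prod Jβ x x := by
  obtain ⟨h0, h1, h2, h3, h4, h5, h6, h7, h8⟩ := coord_nonneg_of_dominant hx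
  rw [prod_eq_sum]
  refine Finset.sum_nonneg fun i _ => mul_nonneg ?_ (hx i)
  fin_cases i <;> assumption

/-! ### Ten mutually tangent members -/

/-- Coordinates of ten mutually tangent members of the packing. -/
def clusterCoord (k j : Fin 10) : ℤ :=
  (![2, 1, 2, 3, 4, 3, 2, 1, 0, -1] : Fin 10 → ℤ) j + if 10 ≤ (j : ℕ) + k then 2 else 0

/-- Ten mutually tangent members of the packing. -/
def cluster (k j : Fin 10) : ℝ := clusterCoord k j

theorem cluster_zero : cluster 0 = boldNode := by
  ext j
  fin_cases j <;> simp [cluster, clusterCoord, boldNode]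

theorem prod_cluster (k l : Fin 10) :
    prod Jβ (cluster k) (cluster l) = if k = l then -2 else 2 := by
  -- Over ℤ the Gram matrix of the cluster is decidable; the result is then cast to ℝ.
  have h : ∀ k l : Fin 10, let x := clusterCoord k
      let y := clusterCoord l
      x 0 * (y 4 - 2 * y 0) + x 1 * (y 2 - 2 * y 1) + x 2 * (y 1 + y 3 - 2 * y 2)
      + x 3 * (y 2 + y 4 - 2 * y 3) + x 4 * (y 0 + y 3 + y 5 - 2 * y 4)
      + x 5 * (y 4 + y 6 - 2 * y 5) + x 6 * (y 5 + y 7 - 2 * y 6)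
      + x 7 * (y 6 + y 8 - 2 * y 7) + x 8 * (y 7 + y 9 - 2 * y 8) + x 9 * (y 8 - 2 * y 9)
      = if k = l then -2 else 2 := by decide
  rw [prod_Jβ]
  have h' := congrArg (Int.cast : ℤ → ℝ) (h k l)
  push_cast at h'
  exact h'

/-- Consecutive cluster vectors differ by 2 β₉₋ₖ, so the Gram matrix of the cluster alone gives β₉₋ₖ
· cₖ = (2 − (−2)) / 2 = 2, which is the reflection formula. -/
theorem cluster_succ (k : Fin 9) : cluster k.succ = refl k.rev.succ (cluster k.castSucc) := by
  have h : ∀ k : Fin 9, ∀ j, clusterCoord k.succ j =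
      clusterCoord k.castSucc j + 2 * if j = k.rev.succ then 1 else 0 := by decide
  have hβ : β k.rev.succ = (2⁻¹ : ℝ) • (cluster k.succ - cluster k.castSucc) := by
    ext j
    simp only [β, cluster, h, Pi.smul_apply, Pi.sub_apply, Pi.single_apply, smul_eq_mul]
    push_cast
    ring
  have h2 : prod Jβ (β k.rev.succ) (cluster k.castSucc) = 2 := by
    rw [hβ, prod_smul_left, prod_sub_left, prod_cluster, prod_cluster,
      if_neg Fin.castSucc_lt_succ.ne', if_pos rfl]
    norm_num
  rw [refl_apply, h2, hβ]
  module

theorem cluster_mem (k : Fin 10) : cluster k ∈ packing := by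
  induction k using Fin.induction with
  | zero => rw [cluster_zero]; exact boldNode_mem
  | succ k ih => rw [cluster_succ]; exact map_mem_packing (refl_mem _) ih

/-- An integral point of the open chamber in the cone over the packing. -/
def interiorPoint : Fin 10 → ℝ := ![110, 57, 116, 177, 240, 195, 152, 111, 72, 35]

/-- The node β₉₋ₖ has products 2 and −2 with cₖ and cₖ₊₁ and 0 with the other cluster vectors, so
weights decreasing by 1 give product 2 with each of β₁, …, β₉. Positive weights are what
`prod_interiorPoint_nonneg` needs. -/
theorem interiorPoint_eq_sum : interiorPoint = ∑ k : Fin 10, (10 - (k : ℕ) : ℝ) • cluster k := by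
  have h : ∀ j, (![110, 57, 116, 177, 240, 195, 152, 111, 72, 35] : Fin 10 → ℤ) j =
      ∑ k : Fin 10, (10 - (k : ℕ) : ℤ) * clusterCoord k j := by decide
  ext j
  have h' : interiorPoint j =
      (((![110, 57, 116, 177, 240, 195, 152, 111, 72, 35] : Fin 10 → ℤ) j : ℤ) : ℝ) := by
    fin_cases j <;> simp [interiorPoint]
  rw [h', h]
  simp [cluster]

theorem isIntegral_interiorPoint : IsIntegral interiorPoint := fun i =>
  ⟨(![110, 57, 116, 177, 240, 195, 152, 111, 72, 35] : Fin 10 → ℤ) i, by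
    fin_cases i <;> simp [interiorPoint]⟩

theorem interiorPoint_dominant (i : Fin 10) : 0 < prod Jβ (β i) interiorPoint := by
  obtain ⟨e0, e1, e2, e3, e4, e5, e6, e7, e8, e9⟩ := prod_β_left interiorPoint
  simp only [interiorPoint] at e0 e1 e2 e3 e4 e5 e6 e7 e8 e9
  simp at e0 e1 e2 e3 e4 e5 e6 e7 e8 e9
  fin_cases i <;> simp only [Fin.reduceFinMk, Fin.zero_eta, Fin.mk_one, interiorPoint, *] <;>
    norm_num

theorem interiorPoint_coord_four : 0 < interiorPoint 4 := by simp [interiorPoint]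

theorem interiorPoint_coord_nine : 0 < interiorPoint 9 := by simp [interiorPoint]

theorem interiorPoint_timelike : 0 < prod Jβ interiorPoint interiorPoint := by
  rw [prod_Jβ]
  simp [interiorPoint]
  norm_num

/-- This common positive side orients the packing: it excludes v + w = 0 and makes the causal vector
v + w future directed. -/
theorem prod_interiorPoint_pos {v : Fin 10 → ℝ} (hv : v ∈ packing) :
    0 < prod Jβ v interiorPoint := by
  obtain ⟨g, hg, rfl⟩ := mem_packing.mp hv
  have h : 0 ≤ prod Jβ (g boldNode - boldNode) interiorPoint := by
    rw [prod_eq_sum]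
    exact Finset.sum_nonneg fun i _ =>
      mul_nonneg (sub_nonneg.mpr (le_map_of_dominant hg boldNode_dominant i))
        (interiorPoint_dominant i).le
  rw [prod_sub_left, prod_boldNode_left] at h
  linarith [interiorPoint_coord_nine]

theorem prod_interiorPoint_nonneg {x : Fin 10 → ℝ} (hx : ∀ v ∈ packing, 0 ≤ prod Jβ v x) :
    0 ≤ prod Jβ interiorPoint x := by
  rw [interiorPoint_eq_sum, prod_sum_left]
  refine Finset.sum_nonneg fun k _ => ?_
  rw [prod_smul_left]
  refine mul_nonneg (sub_nonneg.mpr ?_) (hx _ (cluster_mem k))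
  exact_mod_cast k.2.le

theorem add_ne_zero_of_mem {v w : Fin 10 → ℝ} (hv : v ∈ packing) (hw : w ∈ packing) :
    v + w ≠ 0 := by
  intro h
  have := add_pos (prod_interiorPoint_pos hv) (prod_interiorPoint_pos hw)
  rw [← prod_add_left, h, prod_zero_left] at this
  exact lt_irrefl _ this

theorem isPacking : IsPacking Jβ packing :=
  ⟨⟨2, two_pos, fun _ hv => prod_self_of_mem hv, fun _ hv _ hw => two_le_prod hv hw⟩,
    fun v hv hv' => add_ne_zero_of_mem hv hv' (add_neg_cancel v)⟩

theorem tangent_of_mem {v w : Fin 10 → ℝ} (hv : v ∈ packing) (hw : w ∈ packing)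
    (h : prod Jβ v w = 2) : Tangent Jβ v w := by
  have hv2 := prod_self_of_mem hv
  constructor
  · rw [LinearIndependent.pair_iff]
    intro s t hst
    have h1 : s * (-2) + t * 2 = 0 := by
      have := congrArg (prod Jβ v) hst
      rwa [prod_add_right, prod_smul_right, prod_smul_right, hv2, h, prod_zero_right] at this
    obtain rfl : s = t := by linarith
    rw [← smul_add, smul_eq_zero] at hst
    have hs := hst.resolve_right (add_ne_zero_of_mem hv hw)
    exact ⟨hs, hs⟩
  · rw [h, hv2, prod_self_of_mem hw, neg_neg, Real.mul_self_sqrt zero_le_two, abs_two]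

theorem cluster_injective : Function.Injective cluster := by
  intro k l h
  by_contra hne
  have h1 := prod_cluster k l
  rw [h, prod_cluster, if_pos rfl, if_neg hne] at h1
  norm_num at h1

theorem hasApollonianProperty : HasApollonianProperty Jβ packing := by
  classical
  intro v hv
  obtain ⟨g, hg, rfl⟩ := mem_packing.mp hv
  have hinj : Function.Injective fun k => g (cluster k) := g.injective.comp cluster_injective
  have hmem (k : Fin 10) : g (cluster k) ∈ packing := map_mem_packing hg (cluster_mem k)
  refine ⟨Finset.univ.image fun k => g (cluster k), ?_, ?_, ?_, ?_⟩
  · simpa [Set.range_subset_iff] using hmem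
  · exact Finset.mem_image.mpr ⟨0, Finset.mem_univ _, by rw [cluster_zero]⟩
  · rw [Finset.card_image_of_injective _ hinj, Finset.card_univ, Fintype.card_fin]
  · intro u hu w hw hne
    obtain ⟨k, -, rfl⟩ := Finset.mem_image.mp hu
    obtain ⟨l, -, rfl⟩ := Finset.mem_image.mp hw
    refine tangent_of_mem (hmem k) (hmem l) ?_
    rw [prod_map_map hg, prod_cluster, if_neg fun h => hne (by rw [h])]

/-! ### Sheets -/

/-- Timelike vectors with positive fourth coordinate form one sheet, so D matters only through the
sign of D₄. -/
theorem mem_hyp_iff {D : Fin 10 → ℝ} (hD : 0 < prod Jβ D D) (hD4 : 0 < D 4)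
    {x : Fin 10 → ℝ} : x ∈ hyp Jβ D ↔ prod Jβ x x = 1 ∧ 0 < x 4 := by
  refine and_congr_right fun hx => ?_
  have hx' : 0 < prod Jβ x x := by rw [hx]; exact one_pos
  rw [prod_comm]
  exact ⟨coord_four_pos_of_prod_pos hD.le hx'.le hD4, prod_pos_of_timelike hD hx'.le hD4⟩

theorem mem_lightCone_iff {D : Fin 10 → ℝ} (hD : 0 < prod Jβ D D) (hD4 : 0 < D 4)
    {x : Fin 10 → ℝ} :
    x ∈ lightCone Jβ D ↔ prod Jβ x x = 0 ∧ 0 < x 4 := by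
  refine and_congr_right fun hx => ?_
  rw [prod_comm]
  exact ⟨coord_four_pos_of_prod_pos hD.le hx.ge hD4, prod_pos_of_timelike hD hx.ge hD4⟩

/-! ### The chamber as a fundamental domain -/

theorem finite_integral_bounded (B : ℝ) :
    {y : Fin 10 → ℝ | IsIntegral y ∧ ∀ i, |y i| ≤ B}.Finite := by
  refine ((Set.finite_Icc (fun _ : Fin 10 => -⌈B⌉) fun _ => ⌈B⌉).image
    fun z i => (z i : ℝ)).subset ?_
  rintro y ⟨hy, hB⟩
  choose z hz using hy
  refine ⟨z, ⟨fun i => ?_, fun i => ?_⟩, funext fun i => (hz i).symm⟩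
  · have h := (abs_le.mp (hB i)).1
    have h' := Int.le_ceil B
    have : (-⌈B⌉ : ℝ) ≤ z i := by rw [← hz]; linarith
    exact_mod_cast this
  · have h := (abs_le.mp (hB i)).2
    have h' := Int.le_ceil B
    have : (z i : ℝ) ≤ ⌈B⌉ := by rw [← hz]; linarith
    exact_mod_cast this

/-- Every timelike vector of the positive sheet can be moved into the chamber. -/
theorem exists_map_dominant {x : Fin 10 → ℝ} (hx : 0 < prod Jβ x x) (hx4 : 0 < x 4) :
    ∃ g ∈ Γβ, ∀ i, 0 ≤ prod Jβ (β i) (g⁻¹ x) := by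
  set c := prod Jβ interiorPoint x
  set T : Set (Fin 10 → ℝ) := {y | (∃ g ∈ Γβ, y = g interiorPoint) ∧ prod Jβ y x ≤ c}
  have hfin : T.Finite := by
    -- For y in `T`, the reversed Cauchy-Schwarz inequality gives y₄ (x · x) ≤ 2 x₄ (y · x) ≤ 2 x₄
    -- c; the factor 7 comes from `abs_coord_le`.
    refine (finite_integral_bounded (7 * (2 * x 4 * c / prod Jβ x x))).subset ?_
    rintro y ⟨⟨g, hg, rfl⟩, hy⟩
    have hy4 := coord_four_map_pos hg interiorPoint_timelike interiorPoint_coord_four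
    have hyy : 0 < prod Jβ (g interiorPoint) (g interiorPoint) := by
      rw [prod_map_map hg]; exact interiorPoint_timelike
    refine ⟨isIntegral_interiorPoint.map hg, fun i => (abs_coord_le hyy.le i).trans ?_⟩
    refine mul_le_mul_of_nonneg_left ?_ (by norm_num)
    rw [abs_of_pos hy4, le_div_iff₀ hx]
    have h := reversed_cauchy_schwarz x (g interiorPoint)
    rw [prod_comm x (g interiorPoint)] at h
    have h2 : g interiorPoint 4 * (g interiorPoint 4 * prod Jβ x x)
        ≤ g interiorPoint 4 * (2 * x 4 * prod Jβ (g interiorPoint) x) := by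
      nlinarith [mul_nonneg (sq_nonneg (x 4)) hyy.le]
    refine (le_of_mul_le_mul_left h2 hy4).trans ?_
    exact mul_le_mul_of_nonneg_left hy (by linarith)
  obtain ⟨y, ⟨⟨g, hg, rfl⟩, hy⟩, hmin⟩ := Set.exists_min_image T (fun y => prod Jβ y x) hfin
    ⟨interiorPoint, ⟨1, one_mem _, rfl⟩, le_refl _⟩
  refine ⟨g, hg, fun i => ?_⟩
  rw [← prod_map_left hg]
  by_contra! hlt
  -- A wall with x on its negative side would give an orbit point with smaller product against x.
  have hy' : prod Jβ ((g * refl i) interiorPoint) x < prod Jβ (g interiorPoint) x := by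
    rw [LinearEquiv.mul_apply, refl_apply, map_add, map_smul, prod_add_left, prod_smul_left]
    have := mul_neg_of_pos_of_neg (interiorPoint_dominant i) hlt
    linarith
  have := hmin _ ⟨⟨_, mul_mem hg (refl_mem i), rfl⟩, hy'.le.trans hy⟩
  exact absurd hy' (not_lt.mpr this)

theorem map_mem_hyp {D : Fin 10 → ℝ} (hD : 0 < prod Jβ D D) (hD4 : 0 < D 4)
    {g : (Fin 10 → ℝ) ≃ₗ[ℝ] (Fin 10 → ℝ)} (hg : g ∈ Γβ) {x : Fin 10 → ℝ}
    (hx : x ∈ hyp Jβ D) : g x ∈ hyp Jβ D := by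
  rw [mem_hyp_iff hD hD4] at hx ⊢
  exact ⟨by rw [prod_map_map hg, hx.1],
    coord_four_map_pos hg (by rw [hx.1]; exact one_pos) hx.2⟩

theorem isGeometricallyFinite {D : Fin 10 → ℝ} (hD : 0 < prod Jβ D D) (hD4 : 0 < D 4)
    (hsheet : ∃ x ∈ hyp Jβ D, ∀ i, 0 < prod Jβ (β i) x) : IsGeometricallyFinite Jβ D Γβ := by
  classical
  refine ⟨Finset.univ.image β, ?_, ?_, ?_, ?_⟩
  · simp [prod_β_self]
  · obtain ⟨x, hx, hpos⟩ := hsheet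
    exact ⟨x, hx, by simpa using hpos⟩
  · refine Set.Subset.antisymm ?_ fun x hx => ?_
    · simp only [Set.iUnion_subset_iff, Set.image_subset_iff]
      exact fun g hg x hx => map_mem_hyp hD hD4 hg hx.1
    · obtain ⟨h1, h4⟩ := (mem_hyp_iff hD hD4).mp hx
      obtain ⟨g, hg, hdom⟩ := exists_map_dominant (by rw [h1]; exact one_pos) h4
      simp only [Set.mem_iUnion]
      exact ⟨g, hg, g⁻¹ x, ⟨map_mem_hyp hD hD4 (inv_mem hg) hx, by simpa using hdom⟩,
        g.apply_symm_apply x⟩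
  · intro g hg hne
    rw [Set.disjoint_left]
    rintro _ ⟨x, ⟨-, hx⟩, rfl⟩ ⟨-, hgx⟩
    exact hne (eq_one_of_strictly_dominant hg (by simpa using hx) (by simpa using hgx))

theorem isCrystallographic {D : Fin 10 → ℝ} (hD : 0 < prod Jβ D D) (hD4 : 0 < D 4)
    (hsheet : ∃ x ∈ hyp Jβ D, ∀ i, 0 < prod Jβ (β i) x) :
    IsCrystallographic Jβ D packing := by
  have hmem (x : Fin 10 → ℝ) :
      x ∈ Submodule.span ℤ (Set.range (Pi.basisFun ℝ (Fin 10))) ↔ IsIntegral x := by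
    rw [Module.Basis.mem_span_iff_repr_mem]
    simp [IsIntegral, eq_comm]
  have himage {s : Set (Fin 10 → ℝ)} (hs : ∀ g ∈ Γβ, ∀ x ∈ s, g x ∈ s)
      {g : (Fin 10 → ℝ) ≃ₗ[ℝ] (Fin 10 → ℝ)} (hg : g ∈ Γβ) : g '' s = s := by
    refine Set.Subset.antisymm (Set.image_subset_iff.mpr (hs g hg)) fun x hx => ?_
    exact ⟨g⁻¹ x, hs _ (inv_mem hg) x hx, g.apply_symm_apply x⟩
  refine ⟨Pi.basisFun ℝ (Fin 10), Γβ, {boldNode}, fun g hg => ⟨prod_map_map hg, ?_, ?_⟩,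
    isGeometricallyFinite hD hD4 hsheet, Set.finite_singleton _, ?_, rfl⟩
  · exact himage (fun g hg x => map_mem_hyp hD hD4 hg) hg
  · refine himage (fun g hg x hx => ?_) hg
    rw [SetLike.mem_coe, hmem] at hx ⊢
    exact hx.map hg
  · rw [Set.singleton_subset_iff, SetLike.mem_coe, hmem]
    exact isIntegral_boldNode

/-! ### Sphere packings -/

theorem IsPerspective.prod_infinity_pos {D E : Fin 10 → ℝ}
    {φ : EuclideanSpace ℝ (Fin 8) → Fin 10 → ℝ} (hD : 0 < prod Jβ D D) (hD4 : 0 < D 4)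
    (hφ : IsPerspective Jβ D E φ) (x : EuclideanSpace ℝ (Fin 8)) :
    0 < prod Jβ (φ x) E := by
  obtain ⟨hx, hx4⟩ := (mem_lightCone_iff hD hD4).mp (hφ.mem x)
  obtain ⟨hE, hE4⟩ := (mem_lightCone_iff hD hD4).mp hφ.infinity_mem
  refine (prod_nonneg_of_causal hx.ge hE.ge hx4 hE4).lt_of_ne' fun h => ?_
  exact hφ.ne_infinity x ⟨_, div_pos hx4 hE4, eq_smul_of_null hx hE hE4 h⟩

/-- The sum v + w has norm −4 + 2 v · w ≥ 0. Two distinct common points would add up to a timelike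
vector orthogonal to it, forcing v + w = 0. Being future directed, v + w has nonnegative product
with every boundary point, so v and w cannot both be negative there. -/
theorem isSpherePacking {D E : Fin 10 → ℝ}
    {φ : EuclideanSpace ℝ (Fin 8) → Fin 10 → ℝ} (hD : 0 < prod Jβ D D) (hD4 : 0 < D 4)
    (hφ : IsPerspective Jβ D E φ) : IsSpherePacking Jβ φ packing := by
  intro v hv w hw hne
  have hvw : 0 ≤ prod Jβ (v + w) (v + w) := by
    rw [prod_add_left, prod_add_right, prod_add_right, prod_comm w v, prod_self_of_mem hv,
      prod_self_of_mem hw]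
    linarith [two_le_prod hv hw hne]
  constructor
  · rintro x ⟨hvx, hwx⟩ y ⟨hvy, hwy⟩
    simp only [sphereOf, Set.mem_ofPred_eq] at hvx hwx hvy hwy
    obtain ⟨hx, hx4⟩ := (mem_lightCone_iff hD hD4).mp (hφ.mem x)
    obtain ⟨hy, hy4⟩ := (mem_lightCone_iff hD hD4).mp (hφ.mem y)
    have hxy := prod_nonneg_of_causal hx.ge hy.ge hx4 hy4
    have h0 : prod Jβ (φ x) (φ y) = 0 := by
      by_contra hne0
      refine add_ne_zero_of_mem hv hw
        (eq_zero_of_prod_timelike_eq_zero (x := φ x + φ y) ?_ ?_ hvw)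
      · rw [prod_add_left, prod_add_right, prod_add_right, prod_comm (φ y), hx, hy]
        linarith [hxy.lt_of_ne' hne0]
      · rw [prod_comm, prod_add_left, prod_add_right, prod_add_right, hvx, hwx, hvy, hwy]
        norm_num
    have hd := hφ.dist_sq x y
    rw [h0, mul_zero, zero_div] at hd
    exact dist_eq_zero.mp (pow_eq_zero_iff two_ne_zero |>.mp hd)
  · rw [Set.disjoint_left]
    intro x hvx hwx
    simp only [sideOf, Set.mem_ofPred_eq] at hvx hwx
    obtain ⟨hx, hx4⟩ := (mem_lightCone_iff hD hD4).mp (hφ.mem x)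
    have h4 : 0 < (v + w) 4 := by
      refine coord_four_pos_of_prod_pos interiorPoint_timelike.le hvw interiorPoint_coord_four ?_
      rw [prod_comm, prod_add_left]
      exact add_pos (prod_interiorPoint_pos hv) (prod_interiorPoint_pos hw)
    have h := prod_nonneg_of_causal hvw hx.ge h4 hx4
    rw [prod_add_left] at h
    linarith

/-! ### Existence of perspectives -/

/-- The spacelike coordinates of a vector in a diagonalization of the form. -/
def spatial : (Fin 10 → ℝ) →ₗ[ℝ] EuclideanSpace ℝ (Fin 9) where
  toFun x := WithLp.toLp 2 ![√2 * (x 0 - 1 / 2 * x 4), √2 * (x 1 - 1 / 2 * x 2),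
    √(3 / 2) * (x 2 - 2 / 3 * x 3), √(4 / 3) * (x 3 - 3 / 4 * x 4), √2 * (x 9 - 1 / 2 * x 8),
    √(3 / 2) * (x 8 - 2 / 3 * x 7), √(4 / 3) * (x 7 - 3 / 4 * x 6),
    √(5 / 4) * (x 6 - 4 / 5 * x 5), √(6 / 5) * (x 5 - 5 / 6 * x 4)]
  map_add' x y := by
    ext i
    fin_cases i <;> simp only [Pi.add_apply, PiLp.add_apply] <;> simp <;> ring
  map_smul' c x := by
    ext i
    fin_cases i <;> simp only [Pi.smul_apply, PiLp.smul_apply] <;> simp <;> ring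

/-- Lorentz coordinates: the timelike one and the spacelike ones. -/
def lorentz : (Fin 10 → ℝ) →ₗ[ℝ] ℝ × EuclideanSpace ℝ (Fin 9) :=
  (√(1 / 12) • LinearMap.proj (R := ℝ) (φ := fun _ : Fin 10 => ℝ) 4).prod spatial

theorem lorentz_fst (x : Fin 10 → ℝ) : (lorentz x).1 = √(1 / 12) * x 4 := rfl

theorem prod_eq_lorentz (x y : Fin 10 → ℝ) :
    prod Jβ x y = (lorentz x).1 * (lorentz y).1 - inner ℝ (lorentz x).2 (lorentz y).2 := by
  have key (d : ℝ) (hd : 0 ≤ d) (a b : ℝ) : √d * b * (√d * a) = d * (a * b) := by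
    rw [mul_mul_mul_comm, Real.mul_self_sqrt hd, mul_comm b a]
  have h : inner ℝ (lorentz x).2 (lorentz y).2 =
      2 * ((x 0 - 1 / 2 * x 4) * (y 0 - 1 / 2 * y 4))
      + 2 * ((x 1 - 1 / 2 * x 2) * (y 1 - 1 / 2 * y 2))
      + 3 / 2 * ((x 2 - 2 / 3 * x 3) * (y 2 - 2 / 3 * y 3))
      + 4 / 3 * ((x 3 - 3 / 4 * x 4) * (y 3 - 3 / 4 * y 4))
      + 2 * ((x 9 - 1 / 2 * x 8) * (y 9 - 1 / 2 * y 8))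
      + 3 / 2 * ((x 8 - 2 / 3 * x 7) * (y 8 - 2 / 3 * y 7))
      + 4 / 3 * ((x 7 - 3 / 4 * x 6) * (y 7 - 3 / 4 * y 6))
      + 5 / 4 * ((x 6 - 4 / 5 * x 5) * (y 6 - 4 / 5 * y 5))
      + 6 / 5 * ((x 5 - 5 / 6 * x 4) * (y 5 - 5 / 6 * y 4)) := by
    rw [← key 2 (by norm_num), ← key 2 (by norm_num), ← key (3 / 2) (by norm_num),
      ← key (4 / 3) (by norm_num), ← key 2 (by norm_num), ← key (3 / 2) (by norm_num),
      ← key (4 / 3) (by norm_num), ← key (5 / 4) (by norm_num), ← key (6 / 5) (by norm_num)]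
    simp only [PiLp.inner_apply, Fin.sum_univ_castSucc, Fin.sum_univ_zero, zero_add]
    rfl
  rw [h, lorentz_fst, lorentz_fst, key _ (by norm_num), prod_Jβ]
  ring

theorem lorentz_injective : Function.Injective lorentz := by
  rw [← LinearMap.ker_eq_bot, LinearMap.ker_eq_bot']
  intro x hx
  refine eq_zero_of_coord_four_eq_zero ?_ (by rw [prod_eq_lorentz, hx]; simp)
  have h := lorentz_fst x
  rw [hx] at h
  exact (mul_eq_zero.mp h.symm).resolve_left (by positivity)

/-- Lorentz coordinates as an equivalence. -/
def lorentzEquiv : (Fin 10 → ℝ) ≃ₗ[ℝ] ℝ × EuclideanSpace ℝ (Fin 9) :=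
  LinearMap.linearEquivOfInjective lorentz lorentz_injective (by simp)

theorem lorentz_symm (p : ℝ × EuclideanSpace ℝ (Fin 9)) : lorentz (lorentzEquiv.symm p) = p :=
  lorentzEquiv.apply_symm_apply p

/-- A null vector has a complementary null vector, and the orthogonal complement of the two is a
Euclidean space with the sign of the form reversed. -/
theorem exists_null_frame {E : Fin 10 → ℝ} (hE : prod Jβ E E = 0) (hE4 : 0 < E 4) :
    ∃ (F : Fin 10 → ℝ) (Y : EuclideanSpace ℝ (Fin 8) → Fin 10 → ℝ), prod Jβ F F = 0 ∧
      prod Jβ E F = 1 ∧ (∀ x, prod Jβ E (Y x) = 0) ∧ (∀ x, prod Jβ F (Y x) = 0) ∧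
      (∀ x y, prod Jβ (Y x) (Y y) = -inner ℝ x y) ∧
      ∀ y, prod Jβ E y = 0 → prod Jβ F y = 0 → ∃ x, Y x = y := by
  obtain ⟨a, u, hEau⟩ : ∃ a u, lorentz E = (a, u) := ⟨_, _, rfl⟩
  have ha : 0 < a := by
    have : a = √(1 / 12) * E 4 := by rw [← lorentz_fst, hEau]
    rw [this]
    positivity
  have hu2 : inner ℝ u u = a * a := by
    rw [prod_eq_lorentz, hEau] at hE
    linarith
  have hu : u ≠ 0 := by
    rintro rfl
    rw [inner_zero_left] at hu2
    exact (mul_pos ha ha).ne hu2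
  have : Fact (Module.finrank ℝ (EuclideanSpace ℝ (Fin 9)) = 8 + 1) := ⟨by simp⟩
  let b := OrthonormalBasis.fromOrthogonalSpanSingleton (𝕜 := ℝ) 8 hu
  have horth (q : (Submodule.span ℝ {u})ᗮ) : inner ℝ u (q : EuclideanSpace ℝ (Fin 9)) = 0 :=
    Submodule.mem_orthogonal_singleton_iff_inner_right.mp q.2
  -- Since |u| = a, reversing the spatial part of E and dividing by 2a² gives a null F with E · F =
  -- 1; `Y` parametrizes the orthogonal complement of u in the spatial part.
  refine ⟨lorentzEquiv.symm (1 / (2 * a), -(1 / (2 * (a * a))) • u),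
    fun x => lorentzEquiv.symm (0, (b.repr.symm x : EuclideanSpace ℝ (Fin 9))),
    ?_, ?_, fun x => ?_, fun x => ?_, fun x y => ?_, fun y hEy hFy => ?_⟩
  · rw [prod_eq_lorentz, lorentz_symm]
    simp only [inner_smul_left, inner_smul_right, hu2, RCLike.conj_to_real]
    field_simp
    ring
  · rw [prod_eq_lorentz, lorentz_symm, hEau]
    simp only [inner_smul_right, hu2]
    field_simp
    norm_num
  · rw [prod_eq_lorentz, lorentz_symm, hEau]
    simp [horth]
  · rw [prod_eq_lorentz, lorentz_symm, lorentz_symm]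
    simp [inner_smul_left, horth]
  · rw [prod_eq_lorentz, lorentz_symm, lorentz_symm]
    simp only [mul_zero, zero_sub, neg_inj]
    rw [← Submodule.coe_inner, LinearIsometryEquiv.inner_map_map]
  · obtain ⟨p, q, hpq⟩ : ∃ p q, lorentz y = (p, q) := ⟨_, _, rfl⟩
    rw [prod_eq_lorentz, hEau, hpq] at hEy
    rw [prod_eq_lorentz, lorentz_symm, hpq] at hFy
    simp only [inner_smul_left, RCLike.conj_to_real] at hEy hFy
    have h1 : a * p + inner ℝ u q = 0 := by
      have : 1 / (2 * a) * p - -(1 / (2 * (a * a))) * inner ℝ u q =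
        (1 / (2 * (a * a))) * (a * p + inner ℝ u q) := by field_simp; ring
      rw [this] at hFy
      exact (mul_eq_zero.mp hFy).resolve_left (by positivity)
    have hp : p = 0 := by
      have : a * p = 0 := by linarith
      exact (mul_eq_zero.mp this).resolve_left ha.ne'
    have hq : inner ℝ u q = 0 := by linarith
    refine ⟨b.repr ⟨q, Submodule.mem_orthogonal_singleton_iff_inner_right.mpr hq⟩, ?_⟩
    beta_reduce
    rw [LinearIsometryEquiv.symm_apply_apply, LinearEquiv.symm_apply_eq]
    exact (hpq.trans (by rw [hp])).symm

theorem exists_isPerspective {D E : Fin 10 → ℝ} (hD : 0 < prod Jβ D D) (hD4 : 0 < D 4)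
    (hE : E ∈ lightCone Jβ D) :
    ∃ φ : EuclideanSpace ℝ (Fin 8) → Fin 10 → ℝ, IsPerspective Jβ D E φ := by
  obtain ⟨hE0, hE4⟩ := (mem_lightCone_iff hD hD4).mp hE
  obtain ⟨F, Y, hF, hEF, hEY, hFY, hYY, hsurj⟩ := exists_null_frame hE0 hE4
  have hFE : prod Jβ F E = 1 := by rw [prod_comm, hEF]
  have hYE (x) : prod Jβ (Y x) E = 0 := by rw [prod_comm, hEY]
  have hYF (x) : prod Jβ (Y x) F = 0 := by rw [prod_comm, hFY]
  -- This is the slice A · E = 1 of the light cone: the coefficient of E makes the vector null, and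
  -- products become half the squared distances.
  let φ : EuclideanSpace ℝ (Fin 8) → Fin 10 → ℝ := fun x => F + (‖x‖ ^ 2 / 2) • E + Y x
  have hφφ (x y) : prod Jβ (φ x) (φ y) = dist x y ^ 2 / 2 := by
    simp only [φ, prod_add_left, prod_add_right, prod_smul_left, prod_smul_right, hE0, hF, hEF,
      hFE, hEY, hFY, hYE, hYF, hYY]
    rw [dist_eq_norm, norm_sub_sq_real]
    ring
  have hφE (x) : prod Jβ (φ x) E = 1 := by
    simp only [φ, prod_add_left, prod_smul_left, hE0, hFE, hYE]
    ring
  have hφ0 (x) : prod Jβ (φ x) (φ x) = 0 := by rw [hφφ, dist_self]; norm_num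
  refine ⟨φ, hE, fun x => ?_, fun x => ?_, fun x y => ?_, fun A hA hne => ?_⟩
  · refine (mem_lightCone_iff hD hD4).mpr ⟨hφ0 x, ?_⟩
    refine coord_four_pos_of_prod_pos hE0.ge (hφ0 x).ge hE4 ?_
    rw [prod_comm, hφE]
    exact one_pos
  · rintro ⟨c, -, hc⟩
    have h := hφE x
    rw [hc, prod_smul_left, hE0, mul_zero] at h
    exact zero_ne_one h
  · rw [hφφ, hφE, hφE]
    ring
  · obtain ⟨hA0, hA4⟩ := (mem_lightCone_iff hD hD4).mp hA
    have hAE : 0 < prod Jβ A E := by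
      refine (prod_nonneg_of_causal hA0.ge hE0.ge hA4 hE4).lt_of_ne' fun h => ?_
      exact hne ⟨_, div_pos hA4 hE4, eq_smul_of_null hA0 hE0 hE4 h⟩
    set B := (prod Jβ A E)⁻¹ • A with hB
    have hAB : A = prod Jβ A E • B := by rw [hB, smul_inv_smul₀ hAE.ne']
    have hB0 : prod Jβ B B = 0 := by rw [hB, prod_smul_left, prod_smul_right, hA0]; simp
    have hBE : prod Jβ B E = 1 := by rw [hB, prod_smul_left, inv_mul_cancel₀ hAE.ne']
    have hEB : prod Jβ E B = 1 := by rw [prod_comm, hBE]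
    clear_value B
    -- The component of B orthogonal to E and F determines x; nullity of B then forces F · B = |x|²
    -- / 2.
    obtain ⟨x, hx⟩ := hsurj (B - F - prod Jβ F B • E)
      (by rw [prod_sub_right, prod_sub_right, prod_smul_right, hEB, hEF, hE0]; ring)
      (by rw [prod_sub_right, prod_sub_right, prod_smul_right, hF, hFE]; ring)
    have hnorm : ‖x‖ ^ 2 / 2 = prod Jβ F B := by
      have h := hYY x x
      rw [hx, real_inner_self_eq_norm_sq] at h
      simp only [prod_sub_left, prod_sub_right, prod_smul_left, prod_smul_right, hE0, hF, hEF, hFE,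
        hB0, hBE, hEB, prod_comm B F] at h
      linarith
    refine ⟨x, _, hAE, ?_⟩
    have hφx : φ x = B := by
      simp only [φ, hx, hnorm]
      abel
    rw [hφx]
    exact hAB

/-! ### Maximality -/

/-- An integral vector on the positive side of the whole packing can be moved into the chamber. -/
theorem exists_map_dominant_of_isIntegral {x : Fin 10 → ℝ} (hx : IsIntegral x)
    (hpos : ∀ v ∈ packing, 0 ≤ prod Jβ v x) : ∃ g ∈ Γβ, ∀ i, 0 ≤ prod Jβ (β i) (g x) := by
  -- The product with the interior point is a natural number, and reflecting in a violated wall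
  -- lowers it, so the descent stops in the chamber.
  have hnat (g : (Fin 10 → ℝ) ≃ₗ[ℝ] (Fin 10 → ℝ)) (hg : g ∈ Γβ) :
      ∃ n : ℕ, prod Jβ (g x) interiorPoint = n := by
    obtain ⟨z, hz⟩ := (hx.map hg).exists_prod isIntegral_interiorPoint
    have h0 : 0 ≤ prod Jβ (g x) interiorPoint := by
      rw [prod_comm]
      refine prod_interiorPoint_nonneg fun v hv => ?_
      rw [prod_comm, prod_map_left hg, prod_comm]
      exact hpos _ (map_mem_packing (inv_mem hg) hv)
    rw [hz] at h0 ⊢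
    obtain ⟨n, hn⟩ := Int.eq_ofNat_of_zero_le (by exact_mod_cast h0)
    exact ⟨n, by rw [hn]; simp⟩
  suffices ∀ n : ℕ, ∀ g ∈ Γβ, prod Jβ (g x) interiorPoint = n →
      ∃ g ∈ Γβ, ∀ i, 0 ≤ prod Jβ (β i) (g x) by
    obtain ⟨n, hn⟩ := hnat 1 (one_mem _)
    exact this n 1 (one_mem _) hn
  intro n
  induction n using Nat.strong_induction_on with
  | _ n ih =>
    intro g hg hn
    by_cases hdom : ∀ i, 0 ≤ prod Jβ (β i) (g x)
    · exact ⟨g, hg, hdom⟩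
    push Not at hdom
    obtain ⟨i, hi⟩ := hdom
    have hg' := mul_mem (refl_mem i) hg
    obtain ⟨m, hm⟩ := hnat _ hg'
    refine ih m ?_ _ hg' hm
    rw [LinearEquiv.mul_apply, prod_refl_left, hn] at hm
    have := mul_neg_of_neg_of_pos hi (interiorPoint_dominant i)
    have : (m : ℝ) < n := by linarith
    exact_mod_cast this

/-- Positivity on the packing survives the move into the chamber; applied to ν it makes the ninth
coordinate nonnegative. -/
theorem prod_self_nonneg_of_isIntegral {x : Fin 10 → ℝ} (hx : IsIntegral x)
    (hpos : ∀ v ∈ packing, 0 ≤ prod Jβ v x) : 0 ≤ prod Jβ x x := by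
  obtain ⟨g, hg, hdom⟩ := exists_map_dominant_of_isIntegral hx hpos
  rw [← prod_map_map hg]
  refine prod_self_nonneg_of_dominant hdom ?_
  have h := hpos _ (map_mem_packing (inv_mem hg) boldNode_mem)
  rw [prod_map_left (inv_mem hg), inv_inv, prod_boldNode_left] at h
  linarith

theorem exists_integral_multiple (q : Fin 10 → ℚ) :
    ∃ m : ℝ, 0 < m ∧ IsIntegral (m • fun i => (q i : ℝ)) := by
  refine ⟨((∏ i, (q i).den : ℕ) : ℝ), ?_, fun i => ?_⟩
  · exact_mod_cast Finset.prod_pos fun i _ => (q i).den_pos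
  · obtain ⟨k, hk⟩ := Finset.dvd_prod_of_mem (fun i => (q i).den) (Finset.mem_univ i)
    refine ⟨k * (q i).num, ?_⟩
    rw [Pi.smul_apply, smul_eq_mul, hk]
    have h : ((q i).den : ℝ) * (q i : ℝ) = (q i).num := by
      exact_mod_cast Rat.den_mul_eq_num (q i)
    push_cast
    rw [← h]
    ring

/-- A vector on the positive side of the whole packing is causal. -/
theorem prod_self_nonneg_of_forall {x : Fin 10 → ℝ} (hpos : ∀ v ∈ packing, 0 ≤ prod Jβ v x) :
    0 ≤ prod Jβ x x := by
  by_contra! hx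
  -- Vectors y − x with all βᵢ-products and ninth coordinate positive are nonnegative on the
  -- packing, so y inherits the hypothesis on x. This open set contains rational points, reducing to
  -- the integral case by scaling.
  let U : Set (Fin 10 → ℝ) :=
    {y | prod Jβ y y < 0} ∩ ((⋂ i, {y | 0 < prod Jβ (β i) (y - x)}) ∩ {y | 0 < (y - x) 9})
  have hcont (i : Fin 10) : Continuous fun y : Fin 10 → ℝ => prod Jβ (β i) (y - x) := by
    unfold prod
    fun_prop
  have hU : IsOpen U := by
    refine (isOpen_lt (continuous_prod_self Jβ) continuous_const).inter
      ((isOpen_iInter_of_finite fun i => isOpen_lt continuous_const (hcont i)).inter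
        (isOpen_lt continuous_const ?_))
    fun_prop
  have hne : U.Nonempty := by
    have hc : Continuous fun t : ℝ => prod Jβ (x + t • interiorPoint) (x + t • interiorPoint) :=
      (continuous_prod_self Jβ).comp (by fun_prop)
    have hlt : ∀ᶠ t in nhdsWithin (0 : ℝ) (Set.Ioi 0),
        prod Jβ (x + t • interiorPoint) (x + t • interiorPoint) < 0 :=
      (hc.continuousAt.eventually_lt continuousAt_const (by simpa using hx)).filter_mono
        nhdsWithin_le_nhds
    obtain ⟨t, ht, ht0⟩ := (hlt.and self_mem_nhdsWithin).exists
    refine ⟨x + t • interiorPoint, ht, Set.mem_iInter.mpr fun i => ?_, ?_⟩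
    · simp only [Set.mem_ofPred_eq, add_sub_cancel_left, prod_smul_right]
      exact mul_pos ht0 (interiorPoint_dominant i)
    · simp only [Set.mem_ofPred_eq, add_sub_cancel_left]
      exact mul_pos ht0 interiorPoint_coord_nine
  have hdense : DenseRange fun (q : Fin 10 → ℚ) i => (q i : ℝ) :=
    DenseRange.piMap fun _ => Rat.denseRange_cast
  obtain ⟨q, hq, hdom, h9⟩ := hdense.exists_mem_open hU hne
  obtain ⟨m, hm, hint⟩ := exists_integral_multiple q
  have h := prod_self_nonneg_of_isIntegral hint fun v hv => by
    have := prod_nonneg_of_mem hv (fun i => (Set.mem_iInter.mp hdom i).le) (le_of_lt h9)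
    rw [prod_sub_right] at this
    rw [prod_smul_right]
    exact mul_nonneg hm.le (by linarith [hpos v hv])
  rw [prod_smul_left, prod_smul_right] at h
  have hq' := mul_neg_of_pos_of_neg hm (mul_neg_of_pos_of_neg hm hq)
  linarith

/-- If `v` is negative on the pole of the ball of radius `s` around `C`, then it is negative at some
point `A` of that ball. -/
theorem exists_null_in_ball {C E v : Fin 10 → ℝ} (hC : prod Jβ C C = 0) (hE : prod Jβ E E = 0)
    (hCE : prod Jβ C E = 1) (hv : prod Jβ v v = -2) {s : ℝ} (hs : 0 < s)
    (h : prod Jβ v (C - (s ^ 2 / 2) • E) < 0) :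
    ∃ A, prod Jβ A A = 0 ∧ prod Jβ A E = 1 ∧ 2 * prod Jβ A C ≤ s ^ 2 ∧ prod Jβ v A < 0 := by
  have hEC : prod Jβ E C = 1 := by rw [prod_comm, hCE]
  obtain ⟨a, ha⟩ : ∃ a, prod Jβ v C = a := ⟨_, rfl⟩
  obtain ⟨b, hb⟩ : ∃ b, prod Jβ v E = b := ⟨_, rfl⟩
  have hCv : prod Jβ C v = a := by rw [prod_comm, ha]
  have hEv : prod Jβ E v = b := by rw [prod_comm, hb]
  rw [prod_sub_right, prod_smul_right, ha, hb] at h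
  rcases lt_or_ge a 0 with ha0 | ha0
  · exact ⟨C, hC, hCE, by rw [hC, mul_zero]; positivity, by rwa [ha]⟩
  have hb0 : 0 < b := by
    by_contra! hb0
    nlinarith [mul_nonpos_of_nonneg_of_nonpos (sq_nonneg s) hb0]
  -- The vector v − aE − bC is the part of v orthogonal to C and E, with norm −2 − 2ab. So A moves
  -- from C along the line to the center of the ball of v, reached at t = 1/b, and 2 A · C = t² (2 +
  -- 2ab) is the squared distance covered.
  have hA (t : ℝ) : let A := C + t • (v - a • E - b • C) + (t ^ 2 * (1 + a * b)) • E
      prod Jβ A A = 0 ∧ prod Jβ A E = 1 ∧ prod Jβ A C = t ^ 2 * (1 + a * b) ∧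
      prod Jβ v A = a - t * (2 + 2 * (a * b)) + t ^ 2 * (1 + a * b) * b := by
    simp only [prod_add_left, prod_add_right, prod_sub_left, prod_sub_right, prod_smul_left,
      prod_smul_right, hC, hE, hCE, hEC, ha, hb, hCv, hEv, hv]
    refine ⟨?_, ?_, ?_, ?_⟩ <;> ring
  have hab : 0 ≤ a * b := mul_nonneg ha0 hb0.le
  -- If that center lies within distance s of C, it is the point sought; otherwise go exactly the
  -- distance s towards it, at t = s/k.
  by_cases hcase : 2 + 2 * (a * b) ≤ (b * s) ^ 2
  · obtain ⟨h1, h2, h3, h4⟩ := hA b⁻¹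
    refine ⟨_, h1, h2, ?_, ?_⟩
    · rw [h3, inv_pow, ← mul_assoc, mul_comm 2, mul_assoc, inv_mul_le_iff₀ (by positivity)]
      linarith
    · rw [h4]
      have : a - b⁻¹ * (2 + 2 * (a * b)) + b⁻¹ ^ 2 * (1 + a * b) * b = -b⁻¹ := by
        field_simp
        ring
      rw [this]
      exact neg_neg_of_pos (inv_pos.mpr hb0)
  · push Not at hcase
    have hk2 : √(2 + 2 * (a * b)) ^ 2 = 2 + 2 * (a * b) := Real.sq_sqrt (by positivity)
    have hk0 : 0 < √(2 + 2 * (a * b)) := Real.sqrt_pos.mpr (by positivity)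
    generalize √(2 + 2 * (a * b)) = k at hk2 hk0
    have hk : b * s < k := by
      rw [← hk2] at hcase
      exact lt_of_pow_lt_pow_left₀ 2 hk0.le hcase
    have hk' : 1 + a * b = k ^ 2 / 2 := by linarith
    obtain ⟨h1, h2, h3, h4⟩ := hA (s / k)
    refine ⟨_, h1, h2, ?_, ?_⟩
    · rw [h3, hk']
      field_simp
      exact le_refl _
    · rw [h4, ← hk2, hk']
      have : a - s / k * k ^ 2 + (s / k) ^ 2 * (k ^ 2 / 2) * b = a - s * k + s ^ 2 / 2 * b := by
        field_simp
      rw [this]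
      nlinarith [mul_lt_mul_of_pos_left hk hs]

theorem isMaximal {D E : Fin 10 → ℝ} {φ : EuclideanSpace ℝ (Fin 8) → Fin 10 → ℝ}
    (hD : 0 < prod Jβ D D) (hD4 : 0 < D 4) (hφ : IsPerspective Jβ D E φ) :
    IsMaximal Jβ φ packing := by
  intro c r hr hball
  obtain ⟨hE, hE4⟩ := (mem_lightCone_iff hD hD4).mp hφ.infinity_mem
  obtain ⟨hc, -⟩ := (mem_lightCone_iff hD hD4).mp (hφ.mem c)
  have hcE := hφ.prod_infinity_pos hD hD4 c
  set C := (prod Jβ (φ c) E)⁻¹ • φ c with hCdef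
  have hC : prod Jβ C C = 0 := by rw [hCdef, prod_smul_left, prod_smul_right, hc]; simp
  have hCE : prod Jβ C E = 1 := by rw [hCdef, prod_smul_left, inv_mul_cancel₀ hcE.ne']
  clear_value C
  -- The pole of the sphere of radius s about C has norm −s². The radius is halved because
  -- `exists_null_in_ball` only yields a point of the closed ball.
  have hpole : 0 ≤ prod Jβ (C - ((r / 2) ^ 2 / 2) • E) (C - ((r / 2) ^ 2 / 2) • E) := by
    refine prod_self_nonneg_of_forall fun v hv => ?_
    by_contra! hneg
    obtain ⟨A, hA, hAE, hAC, hvA⟩ :=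
      exists_null_in_ball hC hE hCE (prod_self_of_mem hv) (half_pos hr) hneg
    have hA4 : 0 < A 4 := by
      refine coord_four_pos_of_prod_pos hE.ge hA.ge hE4 ?_
      rw [prod_comm, hAE]
      exact one_pos
    obtain ⟨x, k, hk, rfl⟩ := hφ.surj A ((mem_lightCone_iff hD hD4).mpr ⟨hA, hA4⟩) <| by
      rintro ⟨k, -, rfl⟩
      rw [prod_smul_left, hE, mul_zero] at hAE
      exact zero_ne_one hAE
    rw [prod_smul_left] at hAE
    have hxE := hφ.prod_infinity_pos hD hD4 x
    have hk' : k = (prod Jβ (φ x) E)⁻¹ := eq_inv_of_mul_eq_one_left hAE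
    have hdist : dist x c ^ 2 ≤ (r / 2) ^ 2 := by
      refine le_of_eq_of_le ?_ hAC
      rw [hφ.dist_sq, hCdef, prod_smul_left, prod_smul_right, hk']
      field_simp
    have hx : x ∈ Metric.ball c r := by
      rw [Metric.mem_ball]
      have := abs_le_of_sq_le_sq hdist (half_pos hr).le
      linarith [le_abs_self (dist x c)]
    refine hball hx (Set.mem_iUnion₂.mpr ⟨v, hv, ?_⟩)
    rw [prod_smul_right] at hvA
    exact neg_of_mul_neg_right hvA hk.le
  rw [prod_sub_left, prod_sub_right, prod_sub_right, prod_smul_left, prod_smul_left,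
    prod_smul_right, prod_smul_right, prod_comm E C, hC, hE, hCE] at hpole
  nlinarith [pow_pos hr 2]

end

end Apollonian

theorem mainTheorem1 (D : Fin 10 → ℝ) (hD : 0 < Apollonian.prod Apollonian.Jβ D D)
    (hsheet : ∃ x ∈ Apollonian.hyp Apollonian.Jβ D,
      ∀ i, 0 < Apollonian.prod Apollonian.Jβ (Apollonian.β i) x)
    (ν : Fin 10 → ℝ) (hν : Apollonian.IsBoldNode ν) :
    (∀ E ∈ Apollonian.lightCone Apollonian.Jβ D,
      ∃ φ : EuclideanSpace ℝ (Fin 8) → Fin 10 → ℝ,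
        Apollonian.IsPerspective Apollonian.Jβ D E φ) ∧
    Apollonian.IsApollonian 8 Apollonian.Jβ D (Apollonian.orbit Apollonian.Γβ {ν}) := by
  obtain rfl := hν.eq_boldNode
  -- The given chamber point has positive fourth coordinate and lies on the sheet of D, which fixes
  -- the sign of D₄.
  have hD4 : 0 < D 4 := by
    obtain ⟨x, ⟨hx, hxD⟩, hpos⟩ := hsheet
    exact Apollonian.coord_four_pos_of_prod_pos (by rw [hx]; exact zero_le_one) hD.le
      (Apollonian.coord_four_pos_of_dominant hpos) hxD
  exact ⟨fun E hE => Apollonian.exists_isPerspective hD hD4 hE,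
    { packing := Apollonian.isPacking
      spherePacking := fun E φ hφ => Apollonian.isSpherePacking hD hD4 hφ
      crystallographic := Apollonian.isCrystallographic hD hD4 hsheet
      maximal := fun E φ hφ => Apollonian.isMaximal hD hD4 hφ
      apollonian := Apollonian.hasApollonianProperty }⟩
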